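/- \textbf{Setting.} Let $\Theta\subset\mathbb{R}^d$ be compact and convex, let $\mathcal{X}\subset\mathbb{R}^q$ be a finite set of contexts with $\|x-y\|_2\le B$ for all $x,y\in\mathcal{X}$ and some finite $B>0$, let $\hat P$ be a probability distribution on $\mathcal{X}$, and let $a_1,\dots,a_k$ be actions. For $\theta\in\Theta$ and $\zeta\in\mathcal{X}$ let $\pi_\theta(\cdot\mid\zeta)$ be a probability distribution on the actions, let $\hat m(\zeta,a_i)\in\mathbb{R}$ be given cost estimates, and put $\hat l(\theta,\zeta)=\sum_{i=1}^k\pi_\theta(a_i\mid\zeta)\,\hat m(\zeta,a_i)$. (The policy is given on a neighbourhood of $\Theta$, so that gradients of $\hat l$ in $\theta$ make sense on all of $\Theta$.) For $\eta>0$ and $\epsilon_x>0$ consider the problem of minimizing over $\Theta\times[0,\infty)$ the function $$F(\theta,\lambda)=\mathbb{E}_{x\sim\hat P}\Big[\frac1\eta\log\Big(\sum_{\zeta\in\mathcal{X}}\frac{1}{|\mathcal{X}|}e^{\eta(\hat l(\theta,\zeta)-\lambda\|x-\zeta\|_2^2)}\Big)\Big]+\epsilon_x\lambda .$$ \textbf{Algorithm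 (biased SGD).} Start at $\theta_0\in\Theta$, $\lambda_0\ge 0$. For $t=0,\dots,T-1$: sample $x_t\sim\hat P$ and, independently, $m_t$ i.i.d. points $\zeta_1,\dots,\zeta_{m_t}$ uniformly from $\mathcal{X}$ (all samples being independent of the past); with $g_j=e^{\eta(\hat l(\theta_t,\zeta_j)-\lambda_t\|x_t-\zeta_j\|_2^2)}$ set $$v_t=\frac{\sum_j g_j\nabla_\theta\hat l(\theta_t,\zeta_j)}{\sum_j g_j},\qquad w_t=-\frac{\sum_j g_j\|x_t-\zeta_j\|_2^2}{\sum_j g_j}+\epsilon_x,$$ $$\theta_{t+1}=\Pi_\Theta(\theta_t-\gamma_t v_t),\qquad \lambda_{t+1}=\max\{\lambda_t-\gamma_t w_t,\,0\},$$ where $\Pi_\Theta$ is the Euclidean projection onto $\Theta$. The output $\hat u$ is chosen uniformly at random from $(\theta_0,\lambda_0),\dots,(\theta_{T-1},\lambda_{T-1})$. The total number of queries (evaluations of $\hat l(\cdot,\zeta)$ and its gradient at a sampled point) is $\sum_{t<T}m_t$. \textbf{Theorem.} Suppose that for every $\zeta\in\mathcal{X}$ the function $\hat l(\cdot,\zeta)$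 is $L$-smooth on $\Theta$, that is, differentiable at every point of $\Theta$ with a gradient that is $L$-Lipschitz on $\Theta$. Fix $c>0$ and $\delta_0>0$ and run the algorithm with step sizes $\gamma_t=c\,T^{-1/2}$. (i) If moreover $\hat l(\cdot,\zeta)$ is convex on $\Theta$ for every $\zeta\in\mathcal{X}$, then there are constants $C_m,C_T,C_Q>0$, independent of $\delta$, such that for every $0<\delta\le\delta_0$: whenever $T\ge C_T\delta^{-2}$ and $m_t\ge C_m\delta^{-1}$ for all $t<T$, the output is $\delta$-accurate in expectation, i.e. $$\mathbb{E}[F(\hat u)]-\inf_{\Theta\times[0,\infty)}F\le\delta .$$ In particular $T=\lceil C_T\delta^{-2}\rceil=\mathcal{O}(\delta^{-2})$ iterations with $m_t=\lceil C_m\delta^{-1}\rceil=\mathcal{O}(\delta^{-1})$ suffice, and the total number of queries is then at most $C_Q\delta^{-3}$. (ii) Without convexity of $\hat l$: for every $r>0$ there are constants $C_m,C_T,C_Q>0$, independent of $\delta$, such that for every $0<\delta\le\delta_0$: whenever $T\ge C_T\delta^{-4}$ and $m_t\ge C_m\delta^{-2}$ for all $t<T$, the output is a $\delta$-stationary point in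 expectation, i.e. $$\mathbb{E}\big[\|G_r(\hat u)\|_2^2\big]\le\delta^2,\qquad G_r(u)=\frac1r\Big(u-\Pi_{\Theta\times[0,\infty)}\big(u-r\nabla F(u)\big)\Big),$$ where $G_r$ is the gradient mapping of $F$ (a point of $\Theta\times[0,\infty)$ is a stationary point of the constrained problem exactly when $G_r$ vanishes there). In particular $T=\lceil C_T\delta^{-4}\rceil=\mathcal{O}(\delta^{-4})$ iterations with $m_t=\lceil C_m\delta^{-2}\rceil=\mathcal{O}(\delta^{-2})$ suffice, and the total number of queries is then at most $C_Q\delta^{-6}$. -/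

import Mathlib

noncomputable section

namespace WassersteinOPL

/-- The data of the regularized Wasserstein off-policy learning problem: policy parameters in
`ℝ^d`, contexts in `ℝ^q`, and `k` actions. The policy is a function on the ambient parameter space,
so that gradients in the parameter make sense at the boundary of `Θ`; only its values near `Θ`
matter. -/
structure Problem (d q k : ℕ) where
  /-- the policy parameter space -/
  Θ : Set (EuclideanSpace ℝ (Fin d))
  /-- the (finite) context support set -/
  𝒳 : Finset (EuclideanSpace ℝ (Fin q))
  /-- the nominal distribution of the contexts -/
  ctx : PMF 𝒳
  /-- `pol θ ζ a` is the probability of the action `a` in the context `ζ` -/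
  pol : EuclideanSpace ℝ (Fin d) → 𝒳 → Fin k → ℝ
  /-- the robust cost estimates -/
  mhat : 𝒳 → Fin k → ℝ
  /-- the context uncertainty radius -/
  εx : ℝ
  /-- the smoothing parameter -/
  η : ℝ

/-- The Euclidean projection onto `K`: a point of `K` nearest to `x` (it exists and is unique when
`K` is nonempty, closed and convex). -/
def proj {d : ℕ} (K : Set (EuclideanSpace ℝ (Fin d))) (x : EuclideanSpace ℝ (Fin d)) :
    EuclideanSpace ℝ (Fin d) :=
  Classical.epsilon fun y => y ∈ K ∧ ∀ z ∈ K, dist x y ≤ dist x z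

/-- `f` is `L`-smooth on `S`: differentiable at every point of `S`, with an `L`-Lipschitz
gradient. -/
def SmoothOn {d : ℕ} (L : ℝ) (f : EuclideanSpace ℝ (Fin d) → ℝ)
    (S : Set (EuclideanSpace ℝ (Fin d))) : Prop :=
  (∀ x ∈ S, DifferentiableAt ℝ f x) ∧
    ∀ x ∈ S, ∀ y ∈ S, ‖gradient f x - gradient f y‖ ≤ L * ‖x - y‖

/-- The expectation of `f` under the discrete distribution `p`. It is only used for distributions
of finite support. -/
def expect {α : Type*} (p : PMF α) (f : α → ℝ) : ℝ := ∑' a, (p a).toReal * f a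

namespace Problem

variable {d q k : ℕ} (P : Problem d q k)

/-- The expected robust cost `l̂(θ, ζ) = ∑ₐ π_θ(a | ζ) m̂(ζ, a)`. -/
def lhat (θ : EuclideanSpace ℝ (Fin d)) (ζ : P.𝒳) : ℝ :=
  ∑ a, P.pol θ ζ a * P.mhat ζ a

/-- The weight `g(ζ; θ, λ) = exp (η (l̂(θ, ζ) - λ ‖x - ζ‖²))` for the sampled context `x`. -/
def g (x ζ : P.𝒳) (θ : EuclideanSpace ℝ (Fin d)) (lam : ℝ) : ℝ :=
  Real.exp (P.η * (P.lhat θ ζ - lam * ‖(x : EuclideanSpace ℝ (Fin q)) - ζ‖ ^ 2))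

/-- The regularized objective
`E_{x ∼ P̂} [(1/η) log (∑_ζ (1/|𝒳|) exp (η (l̂(θ, ζ) - λ ‖x - ζ‖²)))] + ε_x λ`. -/
def objective (θ : EuclideanSpace ℝ (Fin d)) (lam : ℝ) : ℝ :=
  ∑ x : P.𝒳, (P.ctx x).toReal *
      (1 / P.η * Real.log (∑ ζ : P.𝒳, 1 / (P.𝒳.card : ℝ) * P.g x ζ θ lam))
    + P.εx * lam

/-- The stochastic gradient in the policy parameter, for the context `x` and the batch `ζ`. -/
def gradθ {m : ℕ} (x : P.𝒳) (ζ : Fin m → P.𝒳) (θ : EuclideanSpace ℝ (Fin d)) (lam : ℝ) :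
    EuclideanSpace ℝ (Fin d) :=
  (∑ j, P.g x (ζ j) θ lam)⁻¹ •
    ∑ j, P.g x (ζ j) θ lam • gradient (fun θ' => P.lhat θ' (ζ j)) θ

/-- The stochastic derivative in the dual variable, for the context `x` and the batch `ζ`. -/
def gradlam {m : ℕ} (x : P.𝒳) (ζ : Fin m → P.𝒳) (θ : EuclideanSpace ℝ (Fin d)) (lam : ℝ) : ℝ :=
  -((∑ j, P.g x (ζ j) θ lam * ‖(x : EuclideanSpace ℝ (Fin q)) - ζ j‖ ^ 2) /
      ∑ j, P.g x (ζ j) θ lam) + P.εx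

/-- The update of the iterate `u = (θ, λ)` with step size `γ`, for the context `x` and the
batch `ζ`. -/
def update {m : ℕ} (γ : ℝ) (u : EuclideanSpace ℝ (Fin d) × ℝ) (x : P.𝒳) (ζ : Fin m → P.𝒳) :
    EuclideanSpace ℝ (Fin d) × ℝ :=
  (proj P.Θ (u.1 - γ • P.gradθ x ζ u.1 u.2), max (u.2 - γ * P.gradlam x ζ u.1 u.2) 0)

/-- One randomized iteration from the iterate `u`: sample a context `x` from the nominal
distribution, sample `m` independent uniform points of `𝒳` (that is, a uniform element of
`Fin m → 𝒳`), and update. -/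
def step (γ : ℝ) (m : ℕ) (u : EuclideanSpace ℝ (Fin d) × ℝ) :
    PMF (EuclideanSpace ℝ (Fin d) × ℝ) :=
  P.ctx.bind fun x =>
    haveI : Nonempty P.𝒳 := ⟨x⟩
    (PMF.uniformOfFintype (Fin m → P.𝒳)).map fun ζ => P.update γ u x ζ

/-- The law of the iterate `u_t = (θ_t, λ_t)` of the biased stochastic gradient descent, with step
sizes `γ_t`, batch sizes `m_t` and starting point `u₀ = (θ₀, λ₀)`. -/
def iterate (γ : ℕ → ℝ) (m : ℕ → ℕ) (u₀ : EuclideanSpace ℝ (Fin d) × ℝ) :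
    ℕ → PMF (EuclideanSpace ℝ (Fin d) × ℝ)
  | 0 => PMF.pure u₀
  | t + 1 => (iterate γ m u₀ t).bind (P.step (γ t) (m t))

/-- The law of the output of a run with `T` iterations: an iterate chosen uniformly at random
from `u_0, …, u_{T-1}`. -/
def output (T : ℕ) [NeZero T] (γ : ℕ → ℝ) (m : ℕ → ℕ) (u₀ : EuclideanSpace ℝ (Fin d) × ℝ) :
    PMF (EuclideanSpace ℝ (Fin d) × ℝ) :=
  (PMF.uniformOfFintype (Fin T)).bind fun t => P.iterate γ m u₀ t

/-- The squared Euclidean norm of the gradient mapping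
`(u - Π (u - r ∇F(u))) / r` of the objective `F` at `u = (θ, λ)`, where `Π` is the projection onto
`Θ × [0, ∞)`; that projection acts on each component. -/
def gradMapSq (r : ℝ) (u : EuclideanSpace ℝ (Fin d) × ℝ) : ℝ :=
  ‖r⁻¹ • (u.1 - proj P.Θ (u.1 - r • gradient (fun θ => P.objective θ u.2) u.1))‖ ^ 2 +
    (r⁻¹ * (u.2 - max (u.2 - r * deriv (fun lam => P.objective u.1 lam) u.2) 0)) ^ 2

end Problem

/-- The number of queries (evaluations of `l̂(·, ζ)` and its gradient at a sampled point) in a run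
of `T` iterations with batch sizes `m_t`. -/
def totalQueries (T : ℕ) (m : ℕ → ℕ) : ℕ := ∑ t ∈ Finset.range T, m t

namespace Problem

variable {d q k : ℕ} (P : Problem d q k)

theorem finite_support_step (γ : ℝ) (m : ℕ) (u : EuclideanSpace ℝ (Fin d) × ℝ) :
    (P.step γ m u).support.Finite := by
  unfold step
  rw [PMF.support_bind]
  refine Set.Finite.biUnion (Set.toFinite _) fun x _ => ?_
  rw [PMF.support_map]
  exact (Set.toFinite _).image _

theorem finite_support_iterate (γ : ℕ → ℝ) (m : ℕ → ℕ) (u₀ : EuclideanSpace ℝ (Fin d) × ℝ)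
    (t : ℕ) : (P.iterate γ m u₀ t).support.Finite := by
  induction t with
  | zero => rw [iterate, PMF.support_pure]; exact Set.finite_singleton _
  | succ t ih =>
    rw [iterate, PMF.support_bind]
    exact Set.Finite.biUnion ih fun u _ => P.finite_support_step _ _ u

/-- The output takes finitely many values, so that its expectations are finite sums. -/
theorem finite_support_output (T : ℕ) [NeZero T] (γ : ℕ → ℝ) (m : ℕ → ℕ)
    (u₀ : EuclideanSpace ℝ (Fin d) × ℝ) : (P.output T γ m u₀).support.Finite := by
  rw [output, PMF.support_bind]
  exact Set.Finite.biUnion (Set.toFinite _) fun t _ => P.finite_support_iterate _ _ _ _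

end Problem

end WassersteinOPL

end

/-! The gradient of `F` is an average over `x` of softmax-weighted means of the scores (the
gradients of the exponents `l̂(θ, ζ) - λ ‖x - ζ‖²`), plus the constant vector `(0, ε_x)`. The
algorithm replaces each weighted mean by its self-normalized version on a batch. That estimator is
biased, but `abs_bias_le` bounds the bias by a multiple of `1 / m` that does not depend on the
weights. Uniformity is essential: `λ` is unbounded along the run, so ratios of weights have no lower
bound.

Nonexpansiveness of the projection and the bias bound give `expect_step_norm_sq_le`, which controls
the expected squared distance of the next iterate to any feasible `z`. Both parts insert it into the
telescoping argument `expect_output_le_of_descent` with different Lyapunov functions.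

Convex case: the Lyapunov function is the squared distance to a comparator `z`. Log-sum-exp is
convex and monotone, so `F` is convex and the inner product dominates `F(u) - F(z)`. The bias is
multiplied by `‖u - z‖`, which is unbounded; but `F` grows at least like `ε_x λ` (`le_objective`),
so `‖u - z‖` is at most `(F(u) - F(z)) / ε_x` plus a constant, and for a small bias the first
summand is absorbed by the descent. Comparators with large `λ` are beaten by `λ = 0`.

Nonconvex case: smoothness of the costs makes `F` weakly convex with a Lipschitz gradient. The
Lyapunov function is the Moreau envelope, the minimum over feasible `z` of `F(z) + (L + 1) ‖z -
u‖²`. One step lowers it by a multiple of the squared distance from `u` to its proximal point, up to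
errors of order `γ²` and `γ b²`, where `b` bounds the bias factor. `norm_gradMap_le` bounds the
gradient mapping by that distance.

With `γ = c / √T` the errors are of order `1 / √T + b` and `1 / √T + b²`; what remains is the choice
of constants. -/

noncomputable section

namespace WassersteinOPL

open scoped RealInnerProductSpace Topology
open Filter

/-! ### Expectations under finitely supported distributions -/

section Expectation

variable {α β : Type*}

theorem expect_eq_sum {p : PMF α} {s : Finset α} (hs : p.support ⊆ s) (f : α → ℝ) :
    expect p f = ∑ a ∈ s, (p a).toReal * f a := by
  refine tsum_eq_sum fun a ha => ?_
  have h0 : p a = 0 := by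
    by_contra h
    exact ha (hs ((PMF.mem_support_iff _ _).2 h))
  simp [h0]

theorem expect_fintype [Fintype α] (p : PMF α) (f : α → ℝ) :
    expect p f = ∑ a, (p a).toReal * f a :=
  tsum_fintype _

theorem sum_toReal_eq_one {p : PMF α} {s : Finset α} (hs : p.support ⊆ s) :
    ∑ a ∈ s, (p a).toReal = 1 := by
  rw [← ENNReal.toReal_sum fun a _ => p.apply_ne_top a,
    ← tsum_eq_sum (f := fun a => p a) (L := .unconditional α) fun a ha => ?_, p.tsum_coe,
    ENNReal.toReal_one]
  by_contra h
  exact ha (hs ((PMF.mem_support_iff _ _).2 h))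

theorem expect_bind {p : PMF α} {q : α → PMF β} (hp : p.support.Finite)
    (hq : ∀ a ∈ p.support, (q a).support.Finite) (f : β → ℝ) :
    expect (p.bind q) f = expect p fun a => expect (q a) f := by
  have hU : (⋃ a ∈ p.support, (q a).support).Finite := hp.biUnion hq
  have hs : (p.bind q).support ⊆ hU.toFinset := by
    rw [PMF.support_bind, Set.Finite.coe_toFinset]
  have hps : p.support ⊆ hp.toFinset := by rw [Set.Finite.coe_toFinset]
  rw [expect_eq_sum hs, expect_eq_sum hps]
  have hb : ∀ b, ((p.bind q) b).toReal = ∑ a ∈ hp.toFinset, (p a).toReal * (q a b).toReal := by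
    intro b
    rw [PMF.bind_apply, tsum_eq_sum (s := hp.toFinset), ENNReal.toReal_sum]
    · simp [ENNReal.toReal_mul]
    · exact fun a _ => ENNReal.mul_ne_top (p.apply_ne_top a) ((q a).apply_ne_top b)
    · intro a ha
      have : p a = 0 := by
        by_contra h
        exact ha (hps ((PMF.mem_support_iff _ _).2 h))
      simp [this]
  simp_rw [hb, Finset.sum_mul]
  rw [Finset.sum_comm]
  refine Finset.sum_congr rfl fun a ha => ?_
  have hqa : (q a).support ⊆ hU.toFinset := by
    rw [Set.Finite.coe_toFinset]
    exact Set.subset_biUnion_of_mem (u := fun a => (q a).support) (hp.mem_toFinset.1 ha)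
  rw [expect_eq_sum hqa, Finset.mul_sum]
  exact Finset.sum_congr rfl fun b _ => by ring

theorem expect_pure (a : α) (f : α → ℝ) : expect (PMF.pure a) f = f a := by
  rw [expect_eq_sum (s := {a}) (by simp)]
  simp

theorem expect_map {p : PMF α} (hp : p.support.Finite) (e : α → β) (f : β → ℝ) :
    expect (p.map e) f = expect p fun a => f (e a) := by
  rw [PMF.map, expect_bind hp fun a _ => by simp [PMF.support_pure]]
  simp [expect_pure]

theorem expect_uniformOfFintype [Fintype α] [Nonempty α] (f : α → ℝ) :
    expect (PMF.uniformOfFintype α) f = (Fintype.card α : ℝ)⁻¹ * ∑ a, f a := by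
  simp [expect_fintype, Finset.mul_sum]

theorem expect_mono {p : PMF α} (hp : p.support.Finite) {f f' : α → ℝ}
    (h : ∀ a ∈ p.support, f a ≤ f' a) : expect p f ≤ expect p f' := by
  have hps : p.support ⊆ hp.toFinset := by rw [Set.Finite.coe_toFinset]
  rw [expect_eq_sum hps, expect_eq_sum hps]
  exact Finset.sum_le_sum fun a ha =>
    mul_le_mul_of_nonneg_left (h a (hp.mem_toFinset.1 ha)) ENNReal.toReal_nonneg

theorem expect_add {p : PMF α} (hp : p.support.Finite) (f f' : α → ℝ) :
    expect p (fun a => f a + f' a) = expect p f + expect p f' := by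
  have hps : p.support ⊆ hp.toFinset := by rw [Set.Finite.coe_toFinset]
  simp only [expect_eq_sum hps, mul_add, Finset.sum_add_distrib]

theorem expect_const_mul (p : PMF α) (c : ℝ) (f : α → ℝ) :
    expect p (fun a => c * f a) = c * expect p f := by
  simp only [expect, ← tsum_mul_left]
  exact tsum_congr fun a => by ring

theorem expect_const {p : PMF α} (hp : p.support.Finite) (c : ℝ) :
    expect p (fun _ => c) = c := by
  have hps : p.support ⊆ hp.toFinset := by rw [Set.Finite.coe_toFinset]
  rw [expect_eq_sum hps, ← Finset.sum_mul, sum_toReal_eq_one hps, one_mul]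

theorem const_le_expect {p : PMF α} (hp : p.support.Finite) {f : α → ℝ} {c : ℝ}
    (h : ∀ a ∈ p.support, c ≤ f a) : c ≤ expect p f :=
  (expect_const hp c).symm.trans_le (expect_mono hp h)

end Expectation

/-! ### Bias of self-normalized sampling -/

section Batch

variable {X : Type*} [Fintype X]

theorem sum_batch_succ (m : ℕ) (f : (Fin (m + 1) → X) → ℝ) :
    ∑ ω, f ω = ∑ x, ∑ ω : Fin m → X, f (Fin.cons x ω) := by
  rw [← Fintype.sum_prod_type']
  exact (Fintype.sum_equiv (Fin.consEquiv fun _ => X) _ _ fun _ => rfl).symm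

theorem sum_batch_centered {a : X → ℝ} (ha : ∑ x, a x = 0) (m : ℕ) :
    ∑ ω : Fin m → X, ∑ j, a (ω j) = 0 := by
  induction m with
  | zero => simp
  | succ m ih =>
    rw [sum_batch_succ]
    simp only [Fin.sum_univ_succ, Fin.cons_zero, Fin.cons_succ, Finset.sum_add_distrib, ih]
    simp [← Finset.mul_sum, ha]

/-- The second moment of a sum of independent centered terms. -/
theorem sum_batch_centered_sq {a : X → ℝ} (ha : ∑ x, a x = 0) (m : ℕ) :
    (Fintype.card X : ℝ) * ∑ ω : Fin m → X, (∑ j, a (ω j)) ^ 2 =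
      m * (Fintype.card X : ℝ) ^ m * ∑ x, a x ^ 2 := by
  induction m with
  | zero => simp
  | succ m ih =>
    have h : ∀ x, ∑ ω : Fin m → X, (a x + ∑ j, a (ω j)) ^ 2 =
        (Fintype.card X : ℝ) ^ m * a x ^ 2 + ∑ ω : Fin m → X, (∑ j, a (ω j)) ^ 2 := by
      intro x
      simp only [add_sq, Finset.sum_add_distrib, ← Finset.mul_sum, sum_batch_centered ha]
      simp
    rw [sum_batch_succ]
    simp only [Fin.sum_univ_succ, Fin.cons_zero, Fin.cons_succ, h, Finset.sum_add_distrib,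
      ← Finset.mul_sum]
    simp only [Finset.sum_const, Finset.card_univ, nsmul_eq_mul, mul_add, ih]
    push_cast
    ring

theorem abs_weighted_avg_le {w v : X → ℝ} (hw : ∀ i, 0 ≤ w i) (hW : 0 < ∑ i, w i) {R : ℝ}
    (hv : ∀ i, |v i| ≤ R) : |(∑ i, w i)⁻¹ * ∑ i, w i * v i| ≤ R := by
  rw [abs_mul, abs_of_pos (inv_pos.2 hW), inv_mul_le_iff₀ hW, Finset.sum_mul]
  refine (Finset.abs_sum_le_sum_abs _ _).trans (Finset.sum_le_sum fun i _ => ?_)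
  rw [abs_mul, abs_of_nonneg (hw i)]
  exact mul_le_mul_of_nonneg_left (hv i) (hw i)

/-- After rescaling the weights to mean one, the error of the ratio estimator is `ρ = N / (1 + A)`
with `N` and `A` batch means of centered terms. Hence `ρ - N = -N A + ρ A²`. Since `N` has mean
zero, the bias is bounded by second moments, each of order `1 / m`; bounding `ρ` by `2 R` avoids any
lower bound on `1 + A`. -/
theorem abs_bias_le_of_pos [Nonempty X] {g f : X → ℝ} (hg : ∀ x, 0 < g x) {R : ℝ} (hR : 0 < R)
    (hf : ∀ x, |f x| ≤ R) {m : ℕ} (hm : 0 < m) :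
    |((Fintype.card (Fin m → X) : ℝ)⁻¹ *
        ∑ ω : Fin m → X, (∑ j, g (ω j))⁻¹ * ∑ j, g (ω j) * f (ω j)) -
      (∑ x, g x)⁻¹ * ∑ x, g x * f x| ≤ 4 * R * Fintype.card X / m := by
  set n : ℝ := (Fintype.card X : ℝ) with hn
  have hn0 : 0 < n := by rw [hn]; exact_mod_cast Fintype.card_pos
  have hm0 : (0 : ℝ) < m := by exact_mod_cast hm
  set S := ∑ x, g x with hS
  have hS0 : 0 < S := Finset.sum_pos (fun x _ => hg x) Finset.univ_nonempty
  set μ := S⁻¹ * ∑ x, g x * f x with hμ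
  have hμS : ∑ x, g x * f x = μ * S := by rw [hμ]; field_simp
  have hμR : |μ| ≤ R := abs_weighted_avg_le (fun x => (hg x).le) hS0 hf
  set a : X → ℝ := fun x => n * g x / S - 1 with ha
  set b : X → ℝ := fun x => n * g x / S * (f x - μ) with hb
  have ha0 : ∑ x, a x = 0 := by
    simp only [ha, Finset.sum_sub_distrib, ← Finset.sum_div, ← Finset.mul_sum, ← hS]
    simp [hS0.ne', ← hn]
  have hb0 : ∑ x, b x = 0 := by
    have : ∀ x, b x = n / S * (g x * f x - μ * g x) := fun x => by simp only [hb]; ring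
    simp only [this, ← Finset.mul_sum, Finset.sum_sub_distrib, hμS, ← hS]
    ring
  have hp1 : ∀ x, g x / S ≤ 1 := fun x => by
    rw [div_le_one hS0]
    exact Finset.single_le_sum (fun x _ => (hg x).le) (Finset.mem_univ x)
  have hpS : ∑ x, g x / S = 1 := by rw [← Finset.sum_div, ← hS, div_self hS0.ne']
  -- The normalized weights are at most one, so their squares sum to at most one. This makes the
  -- bound independent of the spread of the weights.
  have hp2 : ∑ x, (n * g x / S) ^ 2 ≤ n ^ 2 := by
    calc ∑ x, (n * g x / S) ^ 2 ≤ ∑ x, n ^ 2 * (g x / S) := Finset.sum_le_sum fun x _ => by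
          have h0 : 0 ≤ g x / S := (div_pos (hg x) hS0).le
          have : (n * g x / S) ^ 2 = n ^ 2 * (g x / S * (g x / S)) := by ring
          rw [this]
          exact mul_le_mul_of_nonneg_left (mul_le_of_le_one_right h0 (hp1 x)) (sq_nonneg _)
      _ = n ^ 2 := by rw [← Finset.mul_sum, hpS, mul_one]
  have ha2 : ∑ x, a x ^ 2 ≤ n ^ 2 := by
    have h1 : ∑ x, a x ^ 2 = ∑ x, (n * g x / S) ^ 2 - n - 2 * ∑ x, a x := by
      rw [hn, Finset.mul_sum, eq_sub_iff_add_eq, eq_sub_iff_add_eq, ← Finset.sum_add_distrib]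
      have : (Fintype.card X : ℝ) = ∑ x : X, (1 : ℝ) := by simp
      rw [this, ← Finset.sum_add_distrib]
      refine Finset.sum_congr rfl fun x _ => ?_
      rw [← this]
      simp only [ha, ← hn]
      ring
    rw [h1, ha0]
    linarith
  have hb2 : ∑ x, b x ^ 2 ≤ 4 * R ^ 2 * n ^ 2 := by
    calc ∑ x, b x ^ 2 ≤ ∑ x, 4 * R ^ 2 * (n * g x / S) ^ 2 := Finset.sum_le_sum fun x _ => by
          have h1 : |f x - μ| ≤ 2 * R := (abs_sub _ _).trans (by linarith [hf x])
          have h2 : (f x - μ) ^ 2 ≤ (2 * R) ^ 2 := sq_le_sq' (abs_le.1 h1).1 (abs_le.1 h1).2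
          simp only [hb, mul_pow]
          nlinarith [mul_le_mul_of_nonneg_left h2 (sq_nonneg (n * g x / S))]
      _ ≤ 4 * R ^ 2 * n ^ 2 := by
          rw [← Finset.mul_sum]
          exact mul_le_mul_of_nonneg_left hp2 (by positivity)
  have hcard : (Fintype.card (Fin m → X) : ℝ) = n ^ m := by simp [hn]
  have key : ∀ c : X → ℝ, ∑ x, c x = 0 →
      (n ^ m)⁻¹ * ∑ ω : Fin m → X, (1 / m * ∑ j, c (ω j)) ^ 2 = (∑ x, c x ^ 2) / (n * m) := by
    intro c hc
    have := sum_batch_centered_sq hc m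
    rw [← hn] at this
    simp only [mul_pow, ← Finset.mul_sum]
    field_simp
    linarith
  have key1 : ∀ c : X → ℝ, ∑ x, c x = 0 → ∑ ω : Fin m → X, (1 / m * ∑ j, c (ω j)) = 0 := by
    intro c hc
    rw [← Finset.mul_sum, sum_batch_centered hc, mul_zero]
  set N : (Fin m → X) → ℝ := fun ω => 1 / m * ∑ j, b (ω j) with hN
  set A : (Fin m → X) → ℝ := fun ω => 1 / m * ∑ j, a (ω j) with hA
  set ρ : (Fin m → X) → ℝ := fun ω => (∑ j, g (ω j))⁻¹ * (∑ j, g (ω j) * f (ω j)) - μ with hρ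
  have : Nonempty (Fin m) := ⟨⟨0, hm⟩⟩
  have hW : ∀ ω : Fin m → X, 0 < ∑ j, g (ω j) := fun ω =>
    Finset.sum_pos (fun j _ => hg _) Finset.univ_nonempty
  have hρR : ∀ ω, |ρ ω| ≤ 2 * R := fun ω => by
    have := abs_weighted_avg_le (fun j => (hg (ω j)).le) (hW ω) fun j => hf (ω j)
    exact (abs_sub _ _).trans (by linarith)
  have hD : ∀ ω, 1 + A ω = n / (m * S) * ∑ j, g (ω j) := fun ω => by
    have : ∀ j, a (ω j) = n / S * g (ω j) - 1 := fun j => by simp only [ha]; ring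
    simp only [hA, this, Finset.sum_sub_distrib, ← Finset.mul_sum]
    simp
    field_simp
    ring
  have hND : ∀ ω, N ω = ρ ω * (1 + A ω) := fun ω => by
    have : ∀ j, b (ω j) = n / S * (g (ω j) * f (ω j) - μ * g (ω j)) := fun j => by
      simp only [hb]; ring
    rw [hD]
    simp only [hN, hρ, this, Finset.sum_sub_distrib, ← Finset.mul_sum]
    have := (hW ω).ne'
    field_simp
  -- The Young weights reflect that the second moment of `N` is bounded by `4 R²` times the bound
  -- for `A`; the two terms then contribute `R n / m` and `3 R n / m`.
  have hpt : ∀ ω, |ρ ω - N ω| ≤ N ω ^ 2 / (4 * R) + 3 * R * A ω ^ 2 := fun ω => by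
    have h1 : ρ ω - N ω = -(N ω * A ω) + ρ ω * A ω ^ 2 := by rw [hND]; ring
    rw [h1]
    have h2 : |N ω * A ω| ≤ N ω ^ 2 / (4 * R) + R * A ω ^ 2 := by
      have e : N ω ^ 2 / (4 * R) + R * A ω ^ 2 = (N ω ^ 2 + 4 * R ^ 2 * A ω ^ 2) / (4 * R) := by
        field_simp
      rw [e, le_div_iff₀ (by positivity), abs_mul]
      nlinarith [sq_nonneg (|N ω| - 2 * R * |A ω|), sq_abs (N ω), sq_abs (A ω)]
    have h3 : |ρ ω * A ω ^ 2| ≤ 2 * R * A ω ^ 2 := by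
      rw [abs_mul, abs_of_nonneg (sq_nonneg (A ω))]
      exact mul_le_mul_of_nonneg_right (hρR ω) (sq_nonneg _)
    calc _ ≤ |-(N ω * A ω)| + |ρ ω * A ω ^ 2| := abs_add_le _ _
      _ ≤ _ := by rw [abs_neg]; linarith
  have hsum : (n ^ m)⁻¹ * ∑ ω : Fin m → X, (∑ j, g (ω j))⁻¹ * ∑ j, g (ω j) * f (ω j) - μ =
      (n ^ m)⁻¹ * ∑ ω : Fin m → X, (ρ ω - N ω) := by
    rw [Finset.sum_sub_distrib, key1 b hb0, sub_zero]
    simp only [hρ, Finset.sum_sub_distrib, Finset.sum_const, Finset.card_univ, nsmul_eq_mul, hcard]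
    field_simp
  rw [hcard, hsum, abs_mul, abs_of_pos (by positivity)]
  calc (n ^ m)⁻¹ * |∑ ω : Fin m → X, (ρ ω - N ω)|
      ≤ (n ^ m)⁻¹ * ∑ ω : Fin m → X, (N ω ^ 2 / (4 * R) + 3 * R * A ω ^ 2) := by
        refine mul_le_mul_of_nonneg_left ?_ (by positivity)
        exact (Finset.abs_sum_le_sum_abs _ _).trans (Finset.sum_le_sum fun ω _ => hpt ω)
    _ = (∑ x, b x ^ 2) / (n * m) / (4 * R) + 3 * R * ((∑ x, a x ^ 2) / (n * m)) := by
        rw [← key a ha0, ← key b hb0, Finset.sum_add_distrib, ← Finset.sum_div, ← Finset.mul_sum]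
        ring
    _ ≤ (4 * R ^ 2 * n ^ 2) / (n * m) / (4 * R) + 3 * R * (n ^ 2 / (n * m)) := by gcongr
    _ = 4 * R * n / m := by field_simp; ring

/-- A self-normalized importance sampling estimator with `m` uniform samples has a bias of order
`1 / m`, uniformly in the weights. -/
theorem abs_bias_le [Nonempty X] {g f : X → ℝ} (hg : ∀ x, 0 < g x) {R : ℝ}
    (hf : ∀ x, |f x| ≤ R) {m : ℕ} (hm : 0 < m) :
    |((Fintype.card (Fin m → X) : ℝ)⁻¹ *
        ∑ ω : Fin m → X, (∑ j, g (ω j))⁻¹ * ∑ j, g (ω j) * f (ω j)) -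
      (∑ x, g x)⁻¹ * ∑ x, g x * f x| ≤ 4 * R * Fintype.card X / m := by
  have hR : 0 ≤ R := (abs_nonneg _).trans (hf (Classical.arbitrary X))
  rcases hR.eq_or_lt with rfl | hR
  · have h0 : ∀ x, f x = 0 := fun x => abs_nonpos_iff.1 (hf x)
    simp [h0]
  · exact abs_bias_le_of_pos hg hR hf hm

end Batch

/-! ### Projections, proximal points and softmax means in a Hilbert space -/

section Hilbert

variable {H : Type*} [NormedAddCommGroup H] [InnerProductSpace ℝ H]

/-- `π` is the metric projection onto `K`, expressed by its variational inequality. -/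
structure IsProjOnto (K : Set H) (π : H → H) : Prop where
  mem : ∀ w, π w ∈ K
  inner_le : ∀ w, ∀ z ∈ K, ⟪w - π w, z - π w⟫ ≤ 0

namespace IsProjOnto

variable {K : Set H} {π : H → H}

theorem norm_sub_le (h : IsProjOnto K π) (w v : H) : ‖π w - π v‖ ≤ ‖w - v‖ := by
  have h1 := h.inner_le w _ (h.mem v)
  have h2 := h.inner_le v _ (h.mem w)
  have h3 : ‖π w - π v‖ ^ 2 ≤ ⟪w - v, π w - π v⟫ := by
    have e1 : ⟪w - π w, π v - π w⟫ = -⟪w - π w, π w - π v⟫ := by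
      rw [← inner_neg_right, neg_sub]
    have e2 : ‖π w - π v‖ ^ 2 = ⟪w - v, π w - π v⟫ - ⟪w - π w, π w - π v⟫
        + ⟪v - π v, π w - π v⟫ := by
      rw [← inner_sub_left, ← inner_add_left, ← real_inner_self_eq_norm_sq]
      congr 1
      abel
    linarith
  have h4 := h3.trans (real_inner_le_norm _ _)
  by_contra! hlt
  nlinarith [norm_nonneg (w - v), norm_nonneg (π w - π v)]

theorem eq_of_inner_le (h : IsProjOnto K π) {w y : H} (hy : y ∈ K)
    (hw : ∀ z ∈ K, ⟪w - y, z - y⟫ ≤ 0) : π w = y := by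
  have h1 := h.inner_le w y hy
  have h2 := hw _ (h.mem w)
  have e1 : ⟪w - π w, y - π w⟫ = -⟪w - π w, π w - y⟫ := by
    rw [← inner_neg_right, neg_sub]
  have e2 : ‖π w - y‖ ^ 2 = ⟪w - y, π w - y⟫ - ⟪w - π w, π w - y⟫ := by
    rw [← inner_sub_left, ← real_inner_self_eq_norm_sq]
    congr 1
    abel
  have h3 : ‖π w - y‖ ^ 2 ≤ 0 := by linarith
  exact sub_eq_zero.1 (norm_eq_zero.1 (by nlinarith [norm_nonneg (π w - y)]))

theorem apply_of_mem (h : IsProjOnto K π) {z : H} (hz : z ∈ K) : π z = z :=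
  h.eq_of_inner_le hz (by simp)

/-- A point of `K` is fixed by the projection, so nonexpansiveness reduces this to expanding a
square. -/
theorem norm_step_sq_le (h : IsProjOnto K π) {u z : H} (hz : z ∈ K) (γ : ℝ) (s : H) :
    ‖π (u - γ • s) - z‖ ^ 2 ≤ ‖u - z‖ ^ 2 - 2 * γ * ⟪s, u - z⟫ + γ ^ 2 * ‖s‖ ^ 2 := by
  have h1 : ‖π (u - γ • s) - z‖ ≤ ‖(u - z) - γ • s‖ := by
    have := h.norm_sub_le (u - γ • s) z
    rw [h.apply_of_mem hz] at this
    rwa [sub_right_comm]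
  calc ‖π (u - γ • s) - z‖ ^ 2 ≤ ‖(u - z) - γ • s‖ ^ 2 := by gcongr
    _ = _ := by
      rw [norm_sub_sq_real, inner_smul_right, norm_smul, mul_pow, Real.norm_eq_abs, sq_abs,
        real_inner_comm]
      ring

end IsProjOnto

/-- The first-order optimality condition at a proximal point. -/
theorem inner_nonneg_of_prox {K : Set H} (hK : Convex ℝ K) {F : H → ℝ} {DF : H → H} {ρ Λ κ : ℝ}
    (hlow : ∀ u ∈ K, ∀ v ∈ K, F u + ⟪DF u, v - u⟫ - ρ * ‖v - u‖ ^ 2 ≤ F v)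
    (hlip : ∀ u ∈ K, ∀ v ∈ K, ‖DF u - DF v‖ ≤ Λ * ‖u - v‖)
    {u y : H} (hy : y ∈ K)
    (hmin : ∀ z ∈ K, F y + κ * ‖y - u‖ ^ 2 ≤ F z + κ * ‖z - u‖ ^ 2) {z : H} (hz : z ∈ K) :
    0 ≤ ⟪DF y + (2 * κ) • (y - u), z - y⟫ := by
  set I := ⟪DF y + (2 * κ) • (y - u), z - y⟫ with hI
  -- Minimality is tested at `y + s (z - y)`. Differentiability of `F` is not available here: the
  -- lower bound is used from the perturbed point back to `y`, and the Lipschitz bound moves `DF` to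
  -- `y`. Dividing by `s` and letting `s → 0` finishes.
  have hpt : ∀ s : ℝ, 0 < s → s ≤ 1 → 0 ≤ I + s * ((ρ + Λ + κ) * ‖z - y‖ ^ 2) := by
    intro s hs hs1
    set w := y + s • (z - y) with hw
    have hwK : w ∈ K := hK.add_smul_sub_mem hy hz ⟨hs.le, hs1⟩
    have hwy : w - y = s • (z - y) := by rw [hw]; abel
    have h1 := hmin w hwK
    have h2 := hlow w hwK y hy
    have hyw : y - w = -(s • (z - y)) := by rw [← hwy]; abel
    have h3 : ⟪DF w, s • (z - y)⟫ ≤ s * ⟪DF y, z - y⟫ + Λ * s ^ 2 * ‖z - y‖ ^ 2 := by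
      have e : ⟪DF w, s • (z - y)⟫ = s * ⟪DF y, z - y⟫ + ⟪DF w - DF y, s • (z - y)⟫ := by
        rw [inner_sub_left, inner_smul_right (DF y)]; ring
      have h4 := (real_inner_le_norm (DF w - DF y) (s • (z - y))).trans
        (mul_le_mul_of_nonneg_right (hlip w hwK y hy) (norm_nonneg _))
      rw [hwy, norm_smul, Real.norm_of_nonneg hs.le] at h4
      rw [e]
      nlinarith
    have h5 : ‖w - u‖ ^ 2 = ‖y - u‖ ^ 2 + 2 * s * ⟪y - u, z - y⟫ + s ^ 2 * ‖z - y‖ ^ 2 := by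
      have : w - u = (y - u) + s • (z - y) := by rw [hw]; abel
      rw [this, norm_add_sq_real, inner_smul_right, norm_smul, mul_pow, Real.norm_eq_abs, sq_abs]
      ring
    rw [hyw, inner_neg_right, norm_neg, norm_smul, mul_pow, Real.norm_eq_abs, sq_abs] at h2
    rw [h5] at h1
    have h6 : 0 ≤ s * (I + s * ((ρ + Λ + κ) * ‖z - y‖ ^ 2)) := by
      rw [hI, inner_add_left, real_inner_smul_left]
      nlinarith
    exact nonneg_of_mul_nonneg_right h6 hs
  have hlim : Tendsto (fun s : ℝ => I + s * ((ρ + Λ + κ) * ‖z - y‖ ^ 2)) (𝓝[>] 0) (𝓝 I) := by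
    have : Continuous fun s : ℝ => I + s * ((ρ + Λ + κ) * ‖z - y‖ ^ 2) := by fun_prop
    simpa using (this.tendsto 0).mono_left nhdsWithin_le_nhds
  refine ge_of_tendsto hlim ?_
  filter_upwards [Ioc_mem_nhdsGT (zero_lt_one' ℝ)] with s hs using hpt s hs.1 hs.2

/-- The gradient mapping is controlled by the distance to a proximal point. -/
theorem norm_gradMap_le {K : Set H} (hK : Convex ℝ K) {π : H → H} (hπ : IsProjOnto K π)
    {F : H → ℝ} {DF : H → H} {ρ Λ κ : ℝ} (hκ : 0 ≤ κ)
    (hlow : ∀ u ∈ K, ∀ v ∈ K, F u + ⟪DF u, v - u⟫ - ρ * ‖v - u‖ ^ 2 ≤ F v)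
    (hlip : ∀ u ∈ K, ∀ v ∈ K, ‖DF u - DF v‖ ≤ Λ * ‖u - v‖)
    {u y : H} (hu : u ∈ K) (hy : y ∈ K)
    (hmin : ∀ z ∈ K, F y + κ * ‖y - u‖ ^ 2 ≤ F z + κ * ‖z - u‖ ^ 2) {r : ℝ} (hr : 0 < r) :
    ‖r⁻¹ • (u - π (u - r • DF u))‖ ≤ (2 / r + Λ + 2 * κ) * ‖y - u‖ := by
  -- Optimality says that `y` is a fixed point of the projected gradient step of the proximal
  -- problem. Nonexpansiveness then compares this step with the one of `F` at `u`.
  have hfix : π (y - r • (DF y + (2 * κ) • (y - u))) = y := by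
    refine hπ.eq_of_inner_le hy fun z hz => ?_
    have := inner_nonneg_of_prox hK hlow hlip hy hmin hz
    rw [sub_sub_cancel_left, inner_neg_left, real_inner_smul_left]
    nlinarith
  have h1 := hπ.norm_sub_le (y - r • (DF y + (2 * κ) • (y - u))) (u - r • DF u)
  rw [hfix] at h1
  have h2 : y - r • (DF y + (2 * κ) • (y - u)) - (u - r • DF u) =
      (y - u) - r • (DF y - DF u) - r • ((2 * κ) • (y - u)) := by
    simp only [smul_add, smul_sub]; abel
  have h3 : ‖y - r • (DF y + (2 * κ) • (y - u)) - (u - r • DF u)‖ ≤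
      ‖y - u‖ + r * (Λ * ‖y - u‖) + r * (2 * κ * ‖y - u‖) := by
    rw [h2]
    refine (norm_sub_le _ _).trans (add_le_add ((norm_sub_le _ _).trans (add_le_add le_rfl ?_)) ?_)
    · rw [norm_smul, Real.norm_of_nonneg hr.le]
      exact mul_le_mul_of_nonneg_left (hlip y hy u hu) hr.le
    · rw [norm_smul, norm_smul, Real.norm_of_nonneg hr.le, Real.norm_of_nonneg (by positivity)]
  have h4 : ‖u - π (u - r • DF u)‖ ≤ ‖y - u‖ + ‖y - π (u - r • DF u)‖ := by
    have : u - π (u - r • DF u) = (y - π (u - r • DF u)) - (y - u) := by abel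
    rw [this, add_comm]
    exact norm_sub_le _ _
  rw [norm_smul, Real.norm_of_nonneg (by positivity), inv_mul_le_iff₀ hr]
  have e : r * ((2 / r + Λ + 2 * κ) * ‖y - u‖) =
      2 * ‖y - u‖ + r * (Λ * ‖y - u‖) + r * (2 * κ * ‖y - u‖) := by
    field_simp
  rw [e]
  linarith

/-- The weighted mean of a finite family of vectors. -/
def wmean {ι : Type*} [Fintype ι] (w : ι → ℝ) (s : ι → H) : H :=
  (∑ i, w i)⁻¹ • ∑ i, w i • s i

section WeightedMean

variable {ι : Type*} [Fintype ι] {w : ι → ℝ}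

theorem inner_wmean (w : ι → ℝ) (s : ι → H) (v : H) :
    ⟪wmean w s, v⟫ = (∑ i, w i)⁻¹ * ∑ i, w i * ⟪s i, v⟫ := by
  rw [wmean, real_inner_smul_left, sum_inner]
  simp only [real_inner_smul_left]

theorem norm_wmean_le (hw : ∀ i, 0 ≤ w i) {s : ι → H} {G : ℝ} (hG : 0 ≤ G)
    (hs : ∀ i, ‖s i‖ ≤ G) : ‖wmean w s‖ ≤ G := by
  have hW : 0 ≤ ∑ i, w i := Finset.sum_nonneg fun i _ => hw i
  rw [wmean, norm_smul, norm_inv, Real.norm_of_nonneg hW]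
  rcases hW.eq_or_lt with h | h
  · rw [← h]; simpa using hG
  rw [inv_mul_le_iff₀ h, Finset.sum_mul]
  refine (norm_sum_le _ _).trans (Finset.sum_le_sum fun i _ => ?_)
  rw [norm_smul, Real.norm_of_nonneg (hw i)]
  exact mul_le_mul_of_nonneg_left (hs i) (hw i)

theorem wmean_sub (w : ι → ℝ) (s s' : ι → H) :
    wmean w s - wmean w s' = wmean w fun i => s i - s' i := by
  simp only [wmean, smul_sub, Finset.sum_sub_distrib]

/-- The normalized weights depend on the logarithms of the weights in a Lipschitz way. -/
theorem sum_abs_normalized_sub_le [Nonempty ι] {a b : ι → ℝ} {x : ℝ} (hx : 0 ≤ x)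
    (hab : ∀ i, |a i - b i| ≤ x) :
    ∑ i, |Real.exp (a i) / (∑ k, Real.exp (a k)) - Real.exp (b i) / ∑ k, Real.exp (b k)| ≤
      8 * x := by
  have hpos : ∀ c : ι → ℝ, 0 < ∑ k, Real.exp (c k) := fun c =>
    Finset.sum_pos (fun _ _ => Real.exp_pos _) Finset.univ_nonempty
  have hone : ∀ c : ι → ℝ, ∑ i, Real.exp (c i) / (∑ k, Real.exp (c k)) = 1 := fun c => by
    rw [← Finset.sum_div, div_self (hpos c).ne']
  have hnn : ∀ (c : ι → ℝ) i, 0 ≤ Real.exp (c i) / (∑ k, Real.exp (c k)) := fun c i =>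
    div_nonneg (Real.exp_pos _).le (hpos c).le
  have hratio : ∀ c c' : ι → ℝ, (∀ i, |c i - c' i| ≤ x) → ∀ i,
      Real.exp (c i) / (∑ k, Real.exp (c k)) ≤
        Real.exp (2 * x) * (Real.exp (c' i) / ∑ k, Real.exp (c' k)) := by
    intro c c' h i
    have h1 : Real.exp (c i) ≤ Real.exp x * Real.exp (c' i) := by
      rw [← Real.exp_add]
      exact Real.exp_le_exp.2 (by linarith [(abs_le.1 (h i)).2])
    have h2 : ∑ k, Real.exp (c' k) ≤ Real.exp x * ∑ k, Real.exp (c k) := by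
      rw [Finset.mul_sum]
      refine Finset.sum_le_sum fun k _ => ?_
      rw [← Real.exp_add]
      exact Real.exp_le_exp.2 (by linarith [(abs_le.1 (h k)).1])
    rw [← mul_div_assoc, div_le_div_iff₀ (hpos c) (hpos c')]
    calc Real.exp (c i) * ∑ k, Real.exp (c' k)
        ≤ (Real.exp x * Real.exp (c' i)) * (Real.exp x * ∑ k, Real.exp (c k)) := by
          have := (hpos c').le
          gcongr
      _ = Real.exp (2 * x) * Real.exp (c' i) * ∑ k, Real.exp (c k) := by
          rw [two_mul, Real.exp_add]; ring
  -- For small `x`, `exp (2 x) - 1 ≤ 4 x` linearizes the ratio bound; for large `x`, two probability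
  -- vectors differ by at most `2` in total.
  by_cases hx1 : 2 * x ≤ 1
  · have he : Real.exp (2 * x) - 1 ≤ 4 * x := by
      have := Real.abs_exp_sub_one_le (x := 2 * x) (by rwa [abs_of_nonneg (by positivity)])
      rw [abs_of_nonneg (show (0 : ℝ) ≤ 2 * x by positivity)] at this
      linarith [le_abs_self (Real.exp (2 * x) - 1)]
    calc _ ≤ ∑ i, 4 * x * (Real.exp (a i) / (∑ k, Real.exp (a k)) +
          Real.exp (b i) / ∑ k, Real.exp (b k)) := Finset.sum_le_sum fun i _ => by
          have h1 := hratio a b hab i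
          have h2 := hratio b a (fun i => by rw [abs_sub_comm]; exact hab i) i
          have h3 := hnn a i
          have h4 := hnn b i
          rw [abs_le]
          constructor <;> nlinarith
      _ = 8 * x := by rw [← Finset.mul_sum, Finset.sum_add_distrib, hone, hone]; ring
  · calc _ ≤ ∑ i, (Real.exp (a i) / (∑ k, Real.exp (a k)) +
          Real.exp (b i) / ∑ k, Real.exp (b k)) := Finset.sum_le_sum fun i _ => by
          have h3 := hnn a i
          have h4 := hnn b i
          rw [abs_le]
          constructor <;> linarith
      _ = 2 := by rw [Finset.sum_add_distrib, hone, hone]; norm_num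
      _ ≤ 8 * x := by linarith

theorem norm_wmean_exp_sub_le [Nonempty ι] {a b : ι → ℝ} {x : ℝ} (hx : 0 ≤ x)
    (hab : ∀ i, |a i - b i| ≤ x) {s : ι → H} {G : ℝ} (hs : ∀ i, ‖s i‖ ≤ G) :
    ‖wmean (fun i => Real.exp (a i)) s - wmean (fun i => Real.exp (b i)) s‖ ≤ 8 * x * G := by
  have hG : 0 ≤ G := (norm_nonneg _).trans (hs (Classical.arbitrary ι))
  have e : wmean (fun i => Real.exp (a i)) s - wmean (fun i => Real.exp (b i)) s =
      ∑ i, (Real.exp (a i) / (∑ k, Real.exp (a k)) - Real.exp (b i) / ∑ k, Real.exp (b k)) •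
        s i := by
    simp only [wmean, sub_smul, Finset.sum_sub_distrib, Finset.smul_sum, smul_smul, div_eq_inv_mul]
  rw [e]
  calc _ ≤ ∑ i, |Real.exp (a i) / (∑ k, Real.exp (a k)) -
        Real.exp (b i) / ∑ k, Real.exp (b k)| * G := by
        refine (norm_sum_le _ _).trans (Finset.sum_le_sum fun i _ => ?_)
        rw [norm_smul, Real.norm_eq_abs]
        exact mul_le_mul_of_nonneg_left (hs i) (abs_nonneg _)
    _ ≤ 8 * x * G := by
        rw [← Finset.sum_mul]
        exact mul_le_mul_of_nonneg_right (sum_abs_normalized_sub_le hx hab) hG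

/-- The supporting inequality of the log-sum-exp function. -/
theorem wmean_sub_le_logSumExp_sub [Nonempty ι] {η N : ℝ} (hη : 0 < η) (hN : 0 < N)
    (a b : ι → ℝ) :
    (∑ i, Real.exp (η * a i))⁻¹ * ∑ i, Real.exp (η * a i) * (b i - a i) ≤
      1 / η * Real.log (∑ i, 1 / N * Real.exp (η * b i)) -
        1 / η * Real.log (∑ i, 1 / N * Real.exp (η * a i)) := by
  have hpos : ∀ c : ι → ℝ, 0 < ∑ k, Real.exp (η * c k) := fun c =>
    Finset.sum_pos (fun _ _ => Real.exp_pos _) Finset.univ_nonempty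
  set S := ∑ i, Real.exp (η * a i) with hS
  have hS0 : 0 < S := hpos a
  -- Jensen for `exp` under the softmax weights of `a`, applied to the increments `η (b - a)`;
  -- taking logarithms gives the claim.
  have hjen := convexOn_exp.map_sum_le (t := Finset.univ)
    (w := fun i => Real.exp (η * a i) / S) (p := fun i => η * (b i - a i))
    (fun i _ => div_nonneg (Real.exp_pos _).le hS0.le)
    (by rw [← Finset.sum_div, ← hS, div_self hS0.ne']) (fun _ _ => Set.mem_univ _)
  have e1 : ∑ i, (Real.exp (η * a i) / S) • Real.exp (η * (b i - a i)) =
      (∑ i, Real.exp (η * b i)) / S := by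
    rw [Finset.sum_div]
    refine Finset.sum_congr rfl fun i _ => ?_
    rw [smul_eq_mul, div_mul_eq_mul_div, ← Real.exp_add]
    congr 2
    ring
  have e2 : ∑ i, (Real.exp (η * a i) / S) • (η * (b i - a i)) =
      η * (S⁻¹ * ∑ i, Real.exp (η * a i) * (b i - a i)) := by
    rw [Finset.mul_sum, Finset.mul_sum]
    refine Finset.sum_congr rfl fun i _ => ?_
    rw [smul_eq_mul]; ring
  rw [e1, e2, ← Real.le_log_iff_exp_le (div_pos (hpos b) hS0),
    Real.log_div (hpos b).ne' hS0.ne'] at hjen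
  rw [← Finset.mul_sum, ← Finset.mul_sum, ← hS, Real.log_mul (by positivity) (hpos b).ne',
    Real.log_mul (by positivity) hS0.ne', ← mul_sub, add_sub_add_left_eq_sub, one_div_mul_eq_div,
    le_div_iff₀ hη]
  linarith

end WeightedMean

end Hilbert

/-! ### The Euclidean projection -/

section Projection

variable {d : ℕ} {K : Set (EuclideanSpace ℝ (Fin d))}

theorem isProjOnto_proj (hne : K.Nonempty) (hcl : IsClosed K) (hK : Convex ℝ K) :
    IsProjOnto K (proj K) := by
  have hspec : ∀ x, proj K x ∈ K ∧ ∀ z ∈ K, dist x (proj K x) ≤ dist x z := by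
    intro x
    refine Classical.epsilon_spec (p := fun y => y ∈ K ∧ ∀ z ∈ K, dist x y ≤ dist x z) ?_
    obtain ⟨y, hy, hxy⟩ := hcl.exists_infDist_eq_dist hne x
    exact ⟨y, hy, fun z hz => hxy ▸ Metric.infDist_le_dist_of_mem hz⟩
  refine ⟨fun x => (hspec x).1, fun x => ?_⟩
  rw [← norm_eq_iInf_iff_real_inner_le_zero hK (hspec x).1]
  have : Nonempty K := hne.to_subtype
  refine le_antisymm (le_ciInf fun z => ?_) (ciInf_le ⟨0, ?_⟩ (⟨_, (hspec x).1⟩ : K))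
  · simpa only [dist_eq_norm] using (hspec x).2 z z.2
  · rintro _ ⟨z, rfl⟩
    exact norm_nonneg _

end Projection

/-! ### The joint space of parameter and dual variable -/

/-- The space of pairs `(θ, λ)` with its Euclidean norm. -/
abbrev Joint (d : ℕ) := WithLp 2 (EuclideanSpace ℝ (Fin d) × ℝ)

section Joint

variable {d : ℕ}

theorem inner_joint (a b : Joint d) : ⟪a, b⟫ = ⟪a.fst, b.fst⟫ + a.snd * b.snd := by
  rw [WithLp.prod_inner_apply, mul_comm a.snd]
  rfl

theorem norm_sq_joint (a : Joint d) : ‖a‖ ^ 2 = ‖a.fst‖ ^ 2 + a.snd ^ 2 := by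
  rw [WithLp.prod_norm_sq_eq_of_L2, Real.norm_eq_abs, sq_abs]

theorem norm_fst_le (a : Joint d) : ‖a.fst‖ ≤ ‖a‖ :=
  abs_le_of_sq_le_sq' (by nlinarith [norm_sq_joint a, sq_nonneg a.snd]) (norm_nonneg _) |>.2

theorem abs_snd_le (a : Joint d) : |a.snd| ≤ ‖a‖ :=
  abs_le_of_sq_le_sq (by nlinarith [norm_sq_joint a, sq_nonneg ‖a.fst‖]) (norm_nonneg _)

theorem norm_joint_le (a : Joint d) : ‖a‖ ≤ ‖a.fst‖ + |a.snd| := by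
  refine abs_le_of_sq_le_sq' ?_ (by positivity) |>.2
  nlinarith [norm_sq_joint a, sq_abs a.snd, mul_nonneg (norm_nonneg a.fst) (abs_nonneg a.snd)]

theorem sum_fst {ι : Type*} (s : Finset ι) (f : ι → Joint d) :
    (∑ i ∈ s, f i).fst = ∑ i ∈ s, (f i).fst := by
  classical
  induction s using Finset.induction_on with
  | empty => simp
  | insert a s ha ih => rw [Finset.sum_insert ha, Finset.sum_insert ha, WithLp.add_fst, ih]

theorem sum_snd {ι : Type*} (s : Finset ι) (f : ι → Joint d) :
    (∑ i ∈ s, f i).snd = ∑ i ∈ s, (f i).snd := by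
  classical
  induction s using Finset.induction_on with
  | empty => simp
  | insert a s ha ih => rw [Finset.sum_insert ha, Finset.sum_insert ha, WithLp.add_snd, ih]

theorem wmean_fst {ι : Type*} [Fintype ι] (w : ι → ℝ) (s : ι → Joint d) :
    (wmean w s).fst = (∑ i, w i)⁻¹ • ∑ i, w i • (s i).fst := by
  simp [wmean, sum_fst]

theorem wmean_snd {ι : Type*} [Fintype ι] (w : ι → ℝ) (s : ι → Joint d) :
    (wmean w s).snd = (∑ i, w i)⁻¹ * ∑ i, w i * (s i).snd := by
  simp [wmean, sum_snd]

end Joint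

/-! ### First-order inequalities for smooth and convex functions -/

section Calculus

variable {d : ℕ} {f : EuclideanSpace ℝ (Fin d) → ℝ} {S : Set (EuclideanSpace ℝ (Fin d))}

/-- The mean value inequality on the segment, where the gradient deviates from its value at `x` by
at most `L ‖y - x‖`. This gives `L` in place of the sharp `L / 2`, which only affects constants. -/
theorem SmoothOn.abs_sub_inner_le {L : ℝ} (h : SmoothOn L f S) (hL : 0 ≤ L) (hS : Convex ℝ S)
    {x y : EuclideanSpace ℝ (Fin d)} (hx : x ∈ S) (hy : y ∈ S) :
    |f y - f x - ⟪gradient f x, y - x⟫| ≤ L * ‖y - x‖ ^ 2 := by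
  have hseg : segment ℝ x y ⊆ S := hS.segment_subset hx hy
  have := Convex.norm_image_sub_le_of_norm_hasFDerivWithin_le'
    (f := f) (f' := fun z => InnerProductSpace.toDual ℝ _ (gradient f z)) (C := L * ‖y - x‖)
    (φ := InnerProductSpace.toDual ℝ _ (gradient f x)) (s := segment ℝ x y)
    (fun z hz => (h.1 z (hseg hz)).hasGradientAt.hasFDerivAt.hasFDerivWithinAt)
    (fun z hz => by
      rw [← map_sub, LinearIsometryEquiv.norm_map]
      refine (h.2 z (hseg hz) x hx).trans (mul_le_mul_of_nonneg_left ?_ hL)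
      obtain ⟨t, ht, rfl⟩ := (segment_eq_image' ℝ x y ▸ hz)
      rw [add_sub_cancel_left, norm_smul, Real.norm_of_nonneg ht.1]
      exact mul_le_of_le_one_left (norm_nonneg _) ht.2)
    (convex_segment x y) (left_mem_segment ℝ x y) (right_mem_segment ℝ x y)
  rw [Real.norm_eq_abs, InnerProductSpace.toDual_apply_apply] at this
  rw [pow_two, ← mul_assoc]
  exact this

theorem abs_sub_le_of_norm_gradient_le {G : ℝ} (hd : ∀ x ∈ S, DifferentiableAt ℝ f x)
    (hG : ∀ x ∈ S, ‖gradient f x‖ ≤ G) (hS : Convex ℝ S)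
    {x y : EuclideanSpace ℝ (Fin d)} (hx : x ∈ S) (hy : y ∈ S) : |f y - f x| ≤ G * ‖y - x‖ :=
  Convex.norm_image_sub_le_of_norm_hasFDerivWithin_le (f := f)
    (f' := fun z => InnerProductSpace.toDual ℝ _ (gradient f z))
    (fun z hz => (hd z hz).hasGradientAt.hasFDerivAt.hasFDerivWithinAt)
    (fun z hz => by rw [LinearIsometryEquiv.norm_map]; exact hG z hz) hS hx hy

theorem inner_gradient_le_sub_of_convexOn (hf : ConvexOn ℝ S f)
    {x y : EuclideanSpace ℝ (Fin d)} (hx : x ∈ S) (hy : y ∈ S) (hd : DifferentiableAt ℝ f x) :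
    ⟪gradient f x, y - x⟫ ≤ f y - f x := by
  have hline : HasDerivAt (fun s : ℝ => f (x + s • (y - x))) ⟪gradient f x, y - x⟫ 0 := by
    have h1 : HasDerivAt (fun s : ℝ => x + s • (y - x)) (y - x) 0 := by
      simpa using ((hasDerivAt_id (0 : ℝ)).smul_const (y - x)).const_add x
    have h2 : HasFDerivAt f (InnerProductSpace.toDual ℝ _ (gradient f x)) (x + (0 : ℝ) • (y - x)) := by
      simpa using hd.hasGradientAt.hasFDerivAt
    exact h2.comp_hasDerivAt (0 : ℝ) h1
  have hlim := (hasDerivAt_iff_tendsto_slope.1 hline).mono_left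
    (nhdsWithin_mono (0 : ℝ) fun s (hs : s ∈ Set.Ioi 0) => (ne_of_gt hs : s ≠ 0))
  refine le_of_tendsto hlim ?_
  filter_upwards [Ioc_mem_nhdsGT (zero_lt_one' ℝ)] with s hs
  have h3 := hf.2 hx hy (sub_nonneg.2 hs.2) hs.1.le (sub_add_cancel 1 s)
  have e : (1 - s) • x + s • y = x + s • (y - x) := by module
  rw [e, smul_eq_mul, smul_eq_mul] at h3
  rw [slope_def_field, div_le_iff₀ (by linarith [hs.1])]
  simp only [zero_smul, add_zero, sub_zero]
  linarith

end Calculus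

/-! ### Regularity, growth and gradient of the objective -/

namespace Problem

variable {d q k : ℕ} (P : Problem d q k)

/-- The feasible set `Θ × [0, ∞)`. -/
def feas : Set (Joint d) := {w | w.fst ∈ P.Θ ∧ 0 ≤ w.snd}

/-- The projection onto the feasible set. -/
def projFeas (w : Joint d) : Joint d := WithLp.toLp 2 (proj P.Θ w.fst, max w.snd 0)

/-- The exponent `l̂(θ, ζ) - λ ‖x - ζ‖²`. -/
def expo (x ζ : P.𝒳) (u : Joint d) : ℝ :=
  P.lhat u.fst ζ - u.snd * ‖(x : EuclideanSpace ℝ (Fin q)) - ζ‖ ^ 2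

/-- The gradient of the exponent in `(θ, λ)`. -/
def score (x ζ : P.𝒳) (u : Joint d) : Joint d :=
  WithLp.toLp 2 (gradient (fun θ => P.lhat θ ζ) u.fst,
    -‖(x : EuclideanSpace ℝ (Fin q)) - ζ‖ ^ 2)

/-- The gradient of the term `ε_x λ`. -/
def radiusGrad : Joint d := WithLp.toLp 2 (0, P.εx)

/-- The gradient of the objective. -/
def gradObjective (u : Joint d) : Joint d :=
  (∑ x, (P.ctx x).toReal • wmean (fun ζ => P.g x ζ u.fst u.snd) fun ζ => P.score x ζ u)
    + P.radiusGrad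

/-- The stochastic gradient. -/
def stochGrad {m : ℕ} (x : P.𝒳) (ζ : Fin m → P.𝒳) (u : Joint d) : Joint d :=
  wmean (fun j => P.g x (ζ j) u.fst u.snd) (fun j => P.score x (ζ j) u) + P.radiusGrad

theorem g_eq (x ζ : P.𝒳) (u : Joint d) :
    P.g x ζ u.fst u.snd = Real.exp (P.η * P.expo x ζ u) := rfl

theorem g_pos (x ζ : P.𝒳) (θ : EuclideanSpace ℝ (Fin d)) (lam : ℝ) : 0 < P.g x ζ θ lam :=
  Real.exp_pos _

theorem sum_ctx : ∑ x, (P.ctx x).toReal = 1 :=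
  sum_toReal_eq_one (s := Finset.univ) (by simp)

theorem nonempty_contexts : Nonempty P.𝒳 :=
  let ⟨x, _⟩ := P.ctx.support_nonempty
  ⟨x⟩

theorem toLp_update {m : ℕ} (γ : ℝ) (u : EuclideanSpace ℝ (Fin d) × ℝ) (x : P.𝒳)
    (ζ : Fin m → P.𝒳) :
    WithLp.toLp 2 (P.update γ u x ζ) =
      P.projFeas (WithLp.toLp 2 u - γ • P.stochGrad x ζ (WithLp.toLp 2 u)) := by
  have h1 : (P.stochGrad x ζ (WithLp.toLp 2 u)).fst = P.gradθ x ζ u.1 u.2 := by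
    simp [stochGrad, wmean_fst, radiusGrad, score, gradθ]
  have h2 : (P.stochGrad x ζ (WithLp.toLp 2 u)).snd = P.gradlam x ζ u.1 u.2 := by
    simp [stochGrad, wmean_snd, radiusGrad, score, gradlam, div_eq_inv_mul]
  simp only [projFeas, update, WithLp.sub_fst, WithLp.sub_snd, WithLp.smul_fst, WithLp.smul_snd,
    h1, h2]
  rfl

/-- The standing assumptions, with bounds for the costs and the scores. -/
structure Regular (L G M : ℝ) : Prop where
  η_pos : 0 < P.η
  εx_pos : 0 < P.εx
  isCompact : IsCompact P.Θ
  convex : Convex ℝ P.Θ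
  nonempty : P.Θ.Nonempty
  L_nonneg : 0 ≤ L
  smooth : ∀ ζ, SmoothOn L (fun θ => P.lhat θ ζ) P.Θ
  abs_lhat_le : ∀ θ ∈ P.Θ, ∀ ζ, |P.lhat θ ζ| ≤ M
  norm_score_le : ∀ x ζ, ∀ u ∈ P.feas, ‖P.score x ζ u‖ ≤ G

variable {P}

/-- Costs are averages of finitely many numbers. Scores are bounded although `λ` is not: the
exponent is affine in `λ` with slope at most `B²` in absolute value, and a Lipschitz gradient on a
bounded set is bounded. The sign of `L` is not given, hence `|L|`. -/
theorem exists_regular (hη : 0 < P.η) (hε : 0 < P.εx)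
    (hcompact : IsCompact P.Θ) (hconvex : Convex ℝ P.Θ)
    (hpol : ∀ θ ∈ P.Θ, ∀ ζ, P.pol θ ζ ∈ stdSimplex ℝ (Fin k))
    {B : ℝ} (hdiam : ∀ x ∈ P.𝒳, ∀ y ∈ P.𝒳, ‖x - y‖ ≤ B)
    {L : ℝ} (hsmooth : ∀ ζ, SmoothOn L (fun θ => P.lhat θ ζ) P.Θ)
    {θ₀ : EuclideanSpace ℝ (Fin d)} (hθ₀ : θ₀ ∈ P.Θ) :
    ∃ L G M : ℝ, P.Regular L G M := by
  obtain ⟨D, hD⟩ := hcompact.isBounded.exists_norm_le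
  have hsm : ∀ ζ, SmoothOn |L| (fun θ => P.lhat θ ζ) P.Θ := fun ζ =>
    ⟨(hsmooth ζ).1, fun x hx y hy => ((hsmooth ζ).2 x hx y hy).trans
      (mul_le_mul_of_nonneg_right (le_abs_self L) (norm_nonneg _))⟩
  refine ⟨|L|, (∑ ζ, ‖gradient (fun θ => P.lhat θ ζ) θ₀‖) + |L| * (D + D) + B ^ 2,
    ∑ ζ, ∑ a, |P.mhat ζ a|, hη, hε, hcompact, hconvex, ⟨θ₀, hθ₀⟩, abs_nonneg L, hsm, ?_, ?_⟩
  · intro θ hθ ζ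
    calc |P.lhat θ ζ| ≤ ∑ a, |P.mhat ζ a| := by
          refine (Finset.abs_sum_le_sum_abs _ _).trans (Finset.sum_le_sum fun a _ => ?_)
          have hp := hpol θ hθ ζ
          have h1 : P.pol θ ζ a ≤ 1 :=
            hp.2 ▸ Finset.single_le_sum (fun a _ => hp.1 a) (Finset.mem_univ a)
          rw [abs_mul, abs_of_nonneg (hp.1 a)]
          exact mul_le_of_le_one_left (abs_nonneg _) h1
      _ ≤ _ := Finset.single_le_sum (f := fun ζ => ∑ a, |P.mhat ζ a|)
          (fun ζ _ => Finset.sum_nonneg fun a _ => abs_nonneg _) (Finset.mem_univ ζ)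
  · intro x ζ u hu
    refine (norm_joint_le _).trans (add_le_add ?_ ?_)
    · have h1 := (hsm ζ).2 u.fst hu.1 θ₀ hθ₀
      have h2 : ‖u.fst - θ₀‖ ≤ D + D :=
        (norm_sub_le _ _).trans (add_le_add (hD _ hu.1) (hD _ hθ₀))
      have h3 : ‖gradient (fun θ => P.lhat θ ζ) θ₀‖ ≤
          ∑ ζ, ‖gradient (fun θ => P.lhat θ ζ) θ₀‖ :=
        Finset.single_le_sum (f := fun ζ => ‖gradient (fun θ => P.lhat θ ζ) θ₀‖)
          (fun ζ _ => norm_nonneg _) (Finset.mem_univ ζ)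
      have h4 := norm_le_norm_add_norm_sub' (gradient (fun θ => P.lhat θ ζ) u.fst)
        (gradient (fun θ => P.lhat θ ζ) θ₀)
      have h5 := mul_le_mul_of_nonneg_left h2 (abs_nonneg L)
      change ‖gradient (fun θ => P.lhat θ ζ) u.fst‖ ≤ _
      linarith
    · change |-‖(x : EuclideanSpace ℝ (Fin q)) - ζ‖ ^ 2| ≤ _
      rw [abs_neg, abs_of_nonneg (sq_nonneg _)]
      have := hdiam x x.2 ζ ζ.2
      gcongr

namespace Regular

variable {L G M : ℝ} (hP : P.Regular L G M)
include hP

theorem feas_nonempty : P.feas.Nonempty :=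
  let ⟨θ, hθ⟩ := hP.nonempty
  ⟨WithLp.toLp 2 (θ, 0), hθ, le_rfl⟩

theorem G_nonneg : 0 ≤ G :=
  let ⟨u, hu⟩ := hP.feas_nonempty
  let ⟨x⟩ := P.nonempty_contexts
  (norm_nonneg _).trans (hP.norm_score_le x x u hu)

theorem convex_feas : Convex ℝ P.feas := by
  intro u hu v hv a b ha hb hab
  refine ⟨?_, ?_⟩
  · simpa using hP.convex hu.1 hv.1 ha hb hab
  · have := add_nonneg (mul_nonneg ha hu.2) (mul_nonneg hb hv.2)
    simpa using this

theorem isClosed_feas : IsClosed P.feas := by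
  refine IsClosed.inter ?_ ?_
  · exact hP.isCompact.isClosed.preimage
      (continuous_fst.comp (WithLp.prod_continuous_ofLp 2 _ _))
  · exact isClosed_Ici.preimage (continuous_snd.comp (WithLp.prod_continuous_ofLp 2 _ _))

theorem isProjOnto_projFeas : IsProjOnto P.feas P.projFeas := by
  have h := isProjOnto_proj hP.nonempty hP.isCompact.isClosed hP.convex
  refine ⟨fun w => ⟨h.mem _, le_max_right _ _⟩, fun w z hz => ?_⟩
  have h1 := h.inner_le w.fst z.fst hz.1
  have h2 : (w.snd - max w.snd 0) * (z.snd - max w.snd 0) ≤ 0 := by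
    rcases le_total w.snd 0 with h0 | h0
    · rw [max_eq_right h0]
      nlinarith [hz.2]
    · rw [max_eq_left h0]; simp
  rw [inner_joint]
  exact add_nonpos h1 h2

theorem abs_expo_sub_le (x ζ : P.𝒳) {u v : Joint d} (hu : u ∈ P.feas) (hv : v ∈ P.feas) :
    |P.expo x ζ u - P.expo x ζ v| ≤ 2 * G * ‖u - v‖ := by
  have hgr : ∀ θ ∈ P.Θ, ‖gradient (fun θ => P.lhat θ ζ) θ‖ ≤ G := fun θ hθ =>
    (norm_fst_le (P.score x ζ (WithLp.toLp 2 (θ, 0)))).trans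
      (hP.norm_score_le x ζ (WithLp.toLp 2 (θ, 0)) ⟨hθ, le_refl (0 : ℝ)⟩)
  have h1 := abs_sub_le_of_norm_gradient_le (hP.smooth ζ).1 hgr hP.convex hv.1 hu.1
  have h2 : ‖(x : EuclideanSpace ℝ (Fin q)) - ζ‖ ^ 2 ≤ G := by
    have := (abs_snd_le (P.score x ζ u)).trans (hP.norm_score_le x ζ u hu)
    change |-‖(x : EuclideanSpace ℝ (Fin q)) - ζ‖ ^ 2| ≤ _ at this
    rwa [abs_neg, abs_of_nonneg (sq_nonneg _)] at this
  have h3 : ‖u.fst - v.fst‖ ≤ ‖u - v‖ := norm_fst_le (u - v)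
  have h4 : |u.snd - v.snd| ≤ ‖u - v‖ := abs_snd_le (u - v)
  have e : P.expo x ζ u - P.expo x ζ v = (P.lhat u.fst ζ - P.lhat v.fst ζ) -
      (u.snd - v.snd) * ‖(x : EuclideanSpace ℝ (Fin q)) - ζ‖ ^ 2 := by
    simp only [expo]; ring
  rw [e]
  refine (abs_sub _ _).trans ?_
  rw [abs_mul, abs_of_nonneg (sq_nonneg ‖(x : EuclideanSpace ℝ (Fin q)) - ζ‖)]
  have h5 := mul_le_mul h4 h2 (sq_nonneg _) (norm_nonneg _)
  have h6 := mul_le_mul_of_nonneg_left h3 hP.G_nonneg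
  linarith

theorem norm_score_sub_le (x ζ : P.𝒳) {u v : Joint d} (hu : u ∈ P.feas) (hv : v ∈ P.feas) :
    ‖P.score x ζ u - P.score x ζ v‖ ≤ L * ‖u - v‖ := by
  refine (norm_joint_le _).trans ?_
  have h1 := (hP.smooth ζ).2 u.fst hu.1 v.fst hv.1
  have h2 := mul_le_mul_of_nonneg_left (norm_fst_le (u - v)) hP.L_nonneg
  have h3 : (P.score x ζ u - P.score x ζ v).snd = 0 := sub_self _
  rw [h3, abs_zero, add_zero]
  exact h1.trans h2

/-- The objective has a Lipschitz gradient on the feasible set. -/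
theorem norm_gradObjective_sub_le {u v : Joint d} (hu : u ∈ P.feas) (hv : v ∈ P.feas) :
    ‖P.gradObjective u - P.gradObjective v‖ ≤ (L + 16 * P.η * G ^ 2) * ‖u - v‖ := by
  have := P.nonempty_contexts
  have hη := hP.η_pos
  have hG := hP.G_nonneg
  have hx : ∀ x, ‖wmean (fun ζ => P.g x ζ u.fst u.snd) (fun ζ => P.score x ζ u) -
      wmean (fun ζ => P.g x ζ v.fst v.snd) (fun ζ => P.score x ζ v)‖ ≤
      (L + 16 * P.η * G ^ 2) * ‖u - v‖ := by
    intro x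
    -- The scores are changed first, with the weights fixed, and then the weights, whose logarithms
    -- are `2 η G`-Lipschitz.
    have h1 : ‖wmean (fun ζ => P.g x ζ u.fst u.snd) (fun ζ => P.score x ζ u) -
        wmean (fun ζ => P.g x ζ u.fst u.snd) (fun ζ => P.score x ζ v)‖ ≤ L * ‖u - v‖ := by
      rw [wmean_sub]
      exact norm_wmean_le (fun ζ => (P.g_pos _ _ _ _).le)
        (mul_nonneg hP.L_nonneg (norm_nonneg _)) fun ζ => hP.norm_score_sub_le x ζ hu hv
    have h2 : ‖wmean (fun ζ => P.g x ζ u.fst u.snd) (fun ζ => P.score x ζ v) -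
        wmean (fun ζ => P.g x ζ v.fst v.snd) (fun ζ => P.score x ζ v)‖ ≤
        8 * (P.η * (2 * G * ‖u - v‖)) * G := by
      simp only [g_eq]
      refine norm_wmean_exp_sub_le (by positivity) (fun ζ => ?_)
        fun ζ => hP.norm_score_le x ζ v hv
      rw [← mul_sub, abs_mul, abs_of_pos hη]
      exact mul_le_mul_of_nonneg_left (hP.abs_expo_sub_le x ζ hu hv) hη.le
    refine (norm_sub_le_norm_sub_add_norm_sub _ _ _).trans ((add_le_add h1 h2).trans_eq ?_)
    ring
  rw [gradObjective, gradObjective, add_sub_add_right_eq_sub, ← Finset.sum_sub_distrib]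
  calc _ ≤ ∑ x, (P.ctx x).toReal * ((L + 16 * P.η * G ^ 2) * ‖u - v‖) := by
        refine (norm_sum_le _ _).trans (Finset.sum_le_sum fun x _ => ?_)
        rw [← smul_sub, norm_smul, Real.norm_of_nonneg ENNReal.toReal_nonneg]
        exact mul_le_mul_of_nonneg_left (hx x) ENNReal.toReal_nonneg
    _ = _ := by rw [← Finset.sum_mul, P.sum_ctx, one_mul]

/-- Weak convexity of the costs passes to the objective. -/
theorem objective_add_inner_le {ρ : ℝ} (hρ0 : 0 ≤ ρ)
    (hρ : ∀ ζ, ∀ θ ∈ P.Θ, ∀ θ' ∈ P.Θ, P.lhat θ ζ +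
      ⟪gradient (fun θ => P.lhat θ ζ) θ, θ' - θ⟫ - ρ * ‖θ' - θ‖ ^ 2 ≤ P.lhat θ' ζ)
    {u v : Joint d} (hu : u ∈ P.feas) (hv : v ∈ P.feas) :
    P.objective u.fst u.snd + ⟪P.gradObjective u, v - u⟫ - ρ * ‖v - u‖ ^ 2 ≤
      P.objective v.fst v.snd := by
  have := P.nonempty_contexts
  have hN : (0 : ℝ) < P.𝒳.card := by
    exact_mod_cast Finset.card_pos.2 (Finset.nonempty_coe_sort.1 P.nonempty_contexts)
  have hexpo : ∀ x ζ, ⟪P.score x ζ u, v - u⟫ - ρ * ‖v - u‖ ^ 2 ≤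
      P.expo x ζ v - P.expo x ζ u := by
    intro x ζ
    have h1 := hρ ζ u.fst hu.1 v.fst hv.1
    have h2 : ‖(v - u).fst‖ ^ 2 ≤ ‖v - u‖ ^ 2 := by
      have := norm_fst_le (v - u)
      gcongr
    have h3 := mul_le_mul_of_nonneg_left h2 hρ0
    rw [inner_joint]
    simp only [expo, score, WithLp.sub_fst, WithLp.sub_snd, WithLp.toLp_fst,
      WithLp.toLp_snd] at *
    linarith
  have hx : ∀ x, ⟪wmean (fun ζ => P.g x ζ u.fst u.snd) (fun ζ => P.score x ζ u), v - u⟫ -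
      ρ * ‖v - u‖ ^ 2 ≤
      1 / P.η * Real.log (∑ ζ : P.𝒳, 1 / (P.𝒳.card : ℝ) * P.g x ζ v.fst v.snd) -
      1 / P.η * Real.log (∑ ζ : P.𝒳, 1 / (P.𝒳.card : ℝ) * P.g x ζ u.fst u.snd) := by
    intro x
    -- The supporting inequality has nonnegative weights of total mass one, so a common lower bound
    -- on the exponents' linearization errors survives averaging. The exponents are affine in `λ`,
    -- so only `θ` contributes to that error.
    refine le_trans ?_ (wmean_sub_le_logSumExp_sub hP.η_pos hN (fun ζ => P.expo x ζ u)
      fun ζ => P.expo x ζ v)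
    have hS : 0 < ∑ ζ, P.g x ζ u.fst u.snd :=
      Finset.sum_pos (fun _ _ => P.g_pos _ _ _ _) Finset.univ_nonempty
    rw [inner_wmean]
    simp only [← g_eq]
    rw [← mul_le_mul_iff_of_pos_left hS, mul_inv_cancel_left₀ hS.ne', mul_sub,
      mul_inv_cancel_left₀ hS.ne', Finset.sum_mul, ← Finset.sum_sub_distrib]
    refine Finset.sum_le_sum fun ζ _ => ?_
    rw [← mul_sub]
    exact mul_le_mul_of_nonneg_left (hexpo x ζ) (P.g_pos _ _ _ _).le
  have hsum := Finset.sum_le_sum fun x (_ : x ∈ Finset.univ) =>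
    mul_le_mul_of_nonneg_left (hx x) (ENNReal.toReal_nonneg (a := P.ctx x))
  simp only [mul_sub, Finset.sum_sub_distrib] at hsum
  rw [← Finset.sum_mul, P.sum_ctx, one_mul] at hsum
  rw [gradObjective, inner_add_left, sum_inner]
  simp only [real_inner_smul_left]
  have hr : ⟪P.radiusGrad, v - u⟫ = P.εx * v.snd - P.εx * u.snd := by
    rw [inner_joint, ← mul_sub]
    simp [radiusGrad]
  rw [hr]
  simp only [objective]
  linarith

theorem objective_le {u : Joint d} (hu : u ∈ P.feas) :
    P.objective u.fst u.snd ≤ M + P.εx * u.snd := by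
  have := P.nonempty_contexts
  have hη := hP.η_pos
  have hN : (0 : ℝ) < P.𝒳.card := by
    exact_mod_cast Finset.card_pos.2 (Finset.nonempty_coe_sort.1 P.nonempty_contexts)
  have hx : ∀ x, 1 / P.η * Real.log (∑ ζ : P.𝒳, 1 / (P.𝒳.card : ℝ) * P.g x ζ u.fst u.snd) ≤
      M := by
    intro x
    rw [one_div_mul_eq_div, div_le_iff₀ hη, Real.log_le_iff_le_exp
      (Finset.sum_pos (fun ζ _ => mul_pos (one_div_pos.2 hN) (P.g_pos _ _ _ _))
        Finset.univ_nonempty)]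
    calc _ ≤ ∑ ζ : P.𝒳, 1 / (P.𝒳.card : ℝ) * Real.exp (M * P.η) := by
          refine Finset.sum_le_sum fun ζ _ => mul_le_mul_of_nonneg_left ?_ (by positivity)
          rw [g_eq, mul_comm M]
          refine Real.exp_le_exp.2 (mul_le_mul_of_nonneg_left ?_ hη.le)
          have h1 := (abs_le.1 (hP.abs_lhat_le u.fst hu.1 ζ)).2
          have h2 := mul_nonneg hu.2 (sq_nonneg ‖(x : EuclideanSpace ℝ (Fin q)) - ζ‖)
          simp only [expo]
          linarith
      _ = _ := by simp [hN.ne']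
  have := Finset.sum_le_sum fun x (_ : x ∈ Finset.univ) =>
    mul_le_mul_of_nonneg_left (hx x) (ENNReal.toReal_nonneg (a := P.ctx x))
  rw [← Finset.sum_mul, P.sum_ctx, one_mul] at this
  simp only [objective]
  linarith

/-- Only the term `ζ = x` is kept: its transport cost vanishes, so the logarithm is bounded below
uniformly in `λ` and `F` grows in `λ` with slope at least `ε_x`. This replaces compactness in the
`λ` direction. -/
theorem le_objective {u : Joint d} (hu : u ∈ P.feas) :
    -M - Real.log P.𝒳.card / P.η + P.εx * u.snd ≤ P.objective u.fst u.snd := by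
  have := P.nonempty_contexts
  have hη := hP.η_pos
  have hN : (0 : ℝ) < P.𝒳.card := by
    exact_mod_cast Finset.card_pos.2 (Finset.nonempty_coe_sort.1 P.nonempty_contexts)
  have hx : ∀ x, -M - Real.log P.𝒳.card / P.η ≤
      1 / P.η * Real.log (∑ ζ : P.𝒳, 1 / (P.𝒳.card : ℝ) * P.g x ζ u.fst u.snd) := by
    intro x
    have h1 : 1 / (P.𝒳.card : ℝ) * P.g x x u.fst u.snd ≤
        ∑ ζ : P.𝒳, 1 / (P.𝒳.card : ℝ) * P.g x ζ u.fst u.snd :=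
      Finset.single_le_sum (f := fun ζ => 1 / (P.𝒳.card : ℝ) * P.g x ζ u.fst u.snd)
        (fun ζ _ => mul_nonneg (by positivity) (P.g_pos _ _ _ _).le) (Finset.mem_univ x)
    have h2 := Real.log_le_log (mul_pos (one_div_pos.2 hN) (P.g_pos _ _ _ _)) h1
    rw [Real.log_mul (by positivity) (P.g_pos _ _ _ _).ne',
      show Real.log (1 / (P.𝒳.card : ℝ)) = -Real.log P.𝒳.card by rw [one_div, Real.log_inv], g_eq,
      Real.log_exp] at h2
    have h3 : P.expo x x u = P.lhat u.fst x := by simp [expo]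
    have h4 := (abs_le.1 (hP.abs_lhat_le u.fst hu.1 x)).1
    rw [h3] at h2
    rw [one_div_mul_eq_div, le_div_iff₀ hη]
    have e : (-M - Real.log P.𝒳.card / P.η) * P.η = P.η * -M - Real.log P.𝒳.card := by
      field_simp
    rw [e]
    have h5 := mul_le_mul_of_nonneg_left h4 hη.le
    linarith
  have := Finset.sum_le_sum fun x (_ : x ∈ Finset.univ) =>
    mul_le_mul_of_nonneg_left (hx x) (ENNReal.toReal_nonneg (a := P.ctx x))
  rw [← Finset.sum_mul, P.sum_ctx, one_mul] at this
  simp only [objective]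
  linarith

theorem continuousOn_objective : ContinuousOn (fun u : Joint d => P.objective u.fst u.snd)
    P.feas := by
  have := P.nonempty_contexts
  have hN : (0 : ℝ) < P.𝒳.card := by
    exact_mod_cast Finset.card_pos.2 (Finset.nonempty_coe_sort.1 P.nonempty_contexts)
  have hfst : Continuous fun u : Joint d => u.fst :=
    continuous_fst.comp (WithLp.prod_continuous_ofLp 2 _ _)
  have hsnd : Continuous fun u : Joint d => u.snd :=
    continuous_snd.comp (WithLp.prod_continuous_ofLp 2 _ _)
  have hl : ∀ ζ, ContinuousOn (fun u : Joint d => P.lhat u.fst ζ) P.feas := fun ζ =>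
    ContinuousOn.comp (t := P.Θ) (g := fun θ => P.lhat θ ζ)
      (fun θ hθ => ((hP.smooth ζ).1 θ hθ).continuousAt.continuousWithinAt) hfst.continuousOn
      fun u hu => hu.1
  have hg : ∀ x ζ, ContinuousOn (fun u : Joint d => P.g x ζ u.fst u.snd) P.feas := fun x ζ =>
    (continuousOn_const.mul ((hl ζ).sub (hsnd.continuousOn.mul continuousOn_const))).rexp
  refine ContinuousOn.add (continuousOn_finsetSum _ fun x _ => continuousOn_const.mul
    (continuousOn_const.mul (ContinuousOn.log
      (continuousOn_finsetSum _ fun ζ _ => continuousOn_const.mul (hg x ζ)) fun u _ => ?_)))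
    (continuousOn_const.mul hsnd.continuousOn)
  exact (Finset.sum_pos (fun ζ _ => mul_pos (one_div_pos.2 hN) (P.g_pos _ _ _ _))
    Finset.univ_nonempty).ne'

/-- Together with `deriv_objective`, this identifies the explicit formula `gradObjective` with the
partial derivatives in `gradMapSq`. The descent arguments use only the formula. -/
theorem gradient_objective {u : Joint d} (hu : u ∈ P.feas) :
    gradient (fun θ => P.objective θ u.snd) u.fst = (P.gradObjective u).fst := by
  have := P.nonempty_contexts
  have hη := hP.η_pos
  have hN : (0 : ℝ) < P.𝒳.card := by
    exact_mod_cast Finset.card_pos.2 (Finset.nonempty_coe_sort.1 P.nonempty_contexts)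
  have hg : ∀ x ζ, HasFDerivAt (fun θ => P.g x ζ θ u.snd)
      (P.g x ζ u.fst u.snd • P.η • InnerProductSpace.toDual ℝ _
        (gradient (fun θ => P.lhat θ ζ) u.fst)) u.fst := fun x ζ =>
    ((((hP.smooth ζ).1 u.fst hu.1).hasGradientAt.hasFDerivAt.sub_const _).const_mul P.η).exp
  have hx : ∀ x, HasFDerivAt
      (fun θ => 1 / P.η * Real.log (∑ ζ : P.𝒳, 1 / (P.𝒳.card : ℝ) * P.g x ζ θ u.snd))
      (InnerProductSpace.toDual ℝ _
        (wmean (fun ζ => P.g x ζ u.fst u.snd) fun ζ => P.score x ζ u).fst) u.fst := by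
    intro x
    have hS : 0 < ∑ ζ, P.g x ζ u.fst u.snd :=
      Finset.sum_pos (fun _ _ => P.g_pos _ _ _ _) Finset.univ_nonempty
    have hsum : HasFDerivAt (fun θ => ∑ ζ : P.𝒳, 1 / (P.𝒳.card : ℝ) * P.g x ζ θ u.snd) _ u.fst :=
      HasFDerivAt.fun_sum fun ζ (_ : ζ ∈ Finset.univ) => (hg x ζ).const_mul (1 / (P.𝒳.card : ℝ))
    refine ((hsum.log ?_).const_mul (1 / P.η)).congr_fderiv ?_
    · rw [← Finset.mul_sum]
      positivity
    · ext v
      rw [wmean_fst, InnerProductSpace.toDual_apply_apply, real_inner_smul_left, sum_inner,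
        ← Finset.mul_sum]
      simp only [smul_apply, sum_apply, smul_eq_mul,
        InnerProductSpace.toDual_apply_apply, real_inner_smul_left, Finset.mul_sum]
      refine Finset.sum_congr rfl fun ζ _ => ?_
      rw [← Finset.mul_sum]
      change _ = (∑ ζ, P.g x ζ u.fst u.snd)⁻¹ *
        (P.g x ζ u.fst u.snd * ⟪gradient (fun θ => P.lhat θ ζ) u.fst, v⟫)
      field_simp
  have hF : HasFDerivAt (fun θ => P.objective θ u.snd) _ u.fst :=
    (HasFDerivAt.fun_sum fun x (_ : x ∈ Finset.univ) =>
      (hx x).const_mul (P.ctx x).toReal).add_const (P.εx * u.snd)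
  refine HasGradientAt.gradient (hasGradientAt_iff_hasFDerivAt.2 (hF.congr_fderiv ?_))
  ext v
  have h0 : P.radiusGrad.fst = 0 := rfl
  rw [gradObjective, WithLp.add_fst, h0, add_zero, sum_fst,
    InnerProductSpace.toDual_apply_apply, sum_inner]
  simp only [smul_apply, sum_apply, smul_eq_mul,
    InnerProductSpace.toDual_apply_apply, real_inner_smul_left, WithLp.smul_fst]

theorem deriv_objective (u : Joint d) :
    deriv (fun lam => P.objective u.fst lam) u.snd = (P.gradObjective u).snd := by
  have := P.nonempty_contexts
  have hη := hP.η_pos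
  have hN : (0 : ℝ) < P.𝒳.card := by
    exact_mod_cast Finset.card_pos.2 (Finset.nonempty_coe_sort.1 P.nonempty_contexts)
  have hg : ∀ x ζ, HasDerivAt (fun lam => P.g x ζ u.fst lam)
      (P.g x ζ u.fst u.snd * (P.η * (P.score x ζ u).snd)) u.snd := fun x ζ => by
    have h1 := ((hasDerivAt_id u.snd).mul_const
      (‖(x : EuclideanSpace ℝ (Fin q)) - ζ‖ ^ 2)).const_sub (P.lhat u.fst ζ)
    rw [one_mul] at h1
    exact (h1.const_mul P.η).exp
  have hx : ∀ x, HasDerivAt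
      (fun lam => 1 / P.η * Real.log (∑ ζ : P.𝒳, 1 / (P.𝒳.card : ℝ) * P.g x ζ u.fst lam))
      (wmean (fun ζ => P.g x ζ u.fst u.snd) fun ζ => P.score x ζ u).snd u.snd := by
    intro x
    have hS : 0 < ∑ ζ, P.g x ζ u.fst u.snd :=
      Finset.sum_pos (fun _ _ => P.g_pos _ _ _ _) Finset.univ_nonempty
    have hsum : HasDerivAt (fun lam => ∑ ζ : P.𝒳, 1 / (P.𝒳.card : ℝ) * P.g x ζ u.fst lam) _
        u.snd :=
      HasDerivAt.fun_sum fun ζ (_ : ζ ∈ Finset.univ) => (hg x ζ).const_mul (1 / (P.𝒳.card : ℝ))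
    refine ((hsum.log ?_).const_mul (1 / P.η)).congr_deriv ?_
    · rw [← Finset.mul_sum]
      positivity
    · have e : ∑ ζ, P.g x ζ u.fst u.snd * (P.η * (P.score x ζ u).snd) =
          P.η * ∑ ζ, P.g x ζ u.fst u.snd * (P.score x ζ u).snd := by
        rw [Finset.mul_sum]
        exact Finset.sum_congr rfl fun ζ _ => mul_left_comm _ _ _
      rw [wmean_snd, ← Finset.mul_sum, ← Finset.mul_sum, e]
      field_simp
  have hF : HasDerivAt (fun lam => P.objective u.fst lam) _ u.snd :=
    (HasDerivAt.fun_sum fun x (_ : x ∈ Finset.univ) =>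
      (hx x).const_mul (P.ctx x).toReal).add ((hasDerivAt_id u.snd).const_mul P.εx)
  have h0 : P.radiusGrad.snd = P.εx := rfl
  rw [hF.deriv, gradObjective, WithLp.add_snd, h0, mul_one, sum_snd]
  simp only [WithLp.smul_snd, smul_eq_mul]

/-- The gradient mapping in the norm of the joint space. -/
theorem gradMapSq_eq (r : ℝ) {u : EuclideanSpace ℝ (Fin d) × ℝ} (hu : WithLp.toLp 2 u ∈ P.feas) :
    P.gradMapSq r u = ‖r⁻¹ • ((WithLp.toLp 2 u : Joint d) -
      P.projFeas (WithLp.toLp 2 u - r • P.gradObjective (WithLp.toLp 2 u)))‖ ^ 2 := by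
  have h1 := hP.gradient_objective hu
  have h2 := hP.deriv_objective (WithLp.toLp 2 u)
  simp only [WithLp.toLp_fst, WithLp.toLp_snd] at h1 h2
  rw [norm_sq_joint, gradMapSq, h1, h2]
  rfl

end Regular

end Problem

/-! ### Telescoping and the one-step inequality -/

namespace Problem

variable {d q k : ℕ} (P : Problem d q k)

theorem expect_step (γ : ℝ) (m : ℕ) (u : EuclideanSpace ℝ (Fin d) × ℝ)
    (f : EuclideanSpace ℝ (Fin d) × ℝ → ℝ) :
    expect (P.step γ m u) f = ∑ x, (P.ctx x).toReal *
      ((Fintype.card (Fin m → P.𝒳) : ℝ)⁻¹ * ∑ ω : Fin m → P.𝒳, f (P.update γ u x ω)) := by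
  rw [step, expect_bind (Set.toFinite _) fun x _ => ?_, expect_fintype]
  · refine Finset.sum_congr rfl fun x _ => ?_
    have : Nonempty P.𝒳 := ⟨x⟩
    rw [expect_map (Set.toFinite _), expect_uniformOfFintype]
  · rw [PMF.support_map]
    exact (Set.toFinite _).image _

variable {P}

theorem mem_of_mem_support_step {S : Set (EuclideanSpace ℝ (Fin d) × ℝ)} {γ : ℝ} {m : ℕ}
    {u w : EuclideanSpace ℝ (Fin d) × ℝ} (hS : ∀ x (ω : Fin m → P.𝒳), P.update γ u x ω ∈ S)
    (hw : w ∈ (P.step γ m u).support) : w ∈ S := by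
  rw [step, PMF.support_bind] at hw
  obtain ⟨x, -, hx⟩ := Set.mem_iUnion₂.1 hw
  rw [PMF.support_map] at hx
  obtain ⟨ω, -, rfl⟩ := hx
  exact hS x ω

theorem mem_of_mem_support_iterate {S : Set (EuclideanSpace ℝ (Fin d) × ℝ)}
    {γ : ℕ → ℝ} {m : ℕ → ℕ} {u₀ : EuclideanSpace ℝ (Fin d) × ℝ} (hu₀ : u₀ ∈ S)
    (hS : ∀ t, ∀ u ∈ S, ∀ x (ω : Fin (m t) → P.𝒳), P.update (γ t) u x ω ∈ S) (t : ℕ)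
    {u : EuclideanSpace ℝ (Fin d) × ℝ} (hu : u ∈ (P.iterate γ m u₀ t).support) : u ∈ S := by
  induction t generalizing u with
  | zero =>
    rw [iterate, PMF.support_pure, Set.mem_singleton_iff] at hu
    exact hu ▸ hu₀
  | succ t ih =>
    rw [iterate, PMF.support_bind] at hu
    obtain ⟨v, hv, hu⟩ := Set.mem_iUnion₂.1 hu
    exact mem_of_mem_support_step (hS t v (ih hv)) hu

/-- A Lyapunov function that decreases by `R` in expectation, up to an error `κ`, bounds the
expectation of `R` at the output. -/
theorem expect_output_le_of_descent {S : Set (EuclideanSpace ℝ (Fin d) × ℝ)}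
    {V R : EuclideanSpace ℝ (Fin d) × ℝ → ℝ} {V₀ κ : ℝ} {γ : ℕ → ℝ} {m : ℕ → ℕ} {T : ℕ} [NeZero T]
    {u₀ : EuclideanSpace ℝ (Fin d) × ℝ} (hu₀ : u₀ ∈ S)
    (hS : ∀ t, ∀ u ∈ S, ∀ x (ω : Fin (m t) → P.𝒳), P.update (γ t) u x ω ∈ S)
    (hV : ∀ u ∈ S, V₀ ≤ V u)
    (hstep : ∀ t < T, ∀ u ∈ S, expect (P.step (γ t) (m t) u) V ≤ V u - R u + κ) :
    expect (P.output T γ m u₀) R ≤ (V u₀ - V₀) / T + κ := by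
  have hsupp := fun t u => mem_of_mem_support_iterate (u := u) hu₀ hS t
  have hfin := P.finite_support_iterate γ m u₀
  have htel : ∀ t ≤ T, expect (P.iterate γ m u₀ t) V +
      ∑ s ∈ Finset.range t, expect (P.iterate γ m u₀ s) R ≤ V u₀ + t * κ := by
    intro t
    induction t with
    | zero => intro _; simp [iterate, expect_pure]
    | succ t ih =>
      intro ht
      have h1 := ih (Nat.le_of_succ_le ht)
      have h2 : expect (P.iterate γ m u₀ (t + 1)) V ≤
          expect (P.iterate γ m u₀ t) V - expect (P.iterate γ m u₀ t) R + κ := by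
        rw [iterate, expect_bind (hfin t) fun u _ => P.finite_support_step _ _ u]
        refine (expect_mono (hfin t)
          fun u hu => (hstep t ht u (hsupp t u hu)).trans_eq
            (by ring : _ = (V u + (-1) * R u) + κ)).trans_eq ?_
        rw [expect_add (hfin t), expect_add (hfin t), expect_const_mul, expect_const (hfin t)]
        ring
      rw [Finset.sum_range_succ]
      push_cast
      linarith
  have hT : (0 : ℝ) < T := by exact_mod_cast Nat.pos_of_neZero T
  have h1 := htel T le_rfl
  have h2 := const_le_expect (hfin T) fun u hu => hV u (hsupp T u hu)
  rw [output, expect_bind (Set.toFinite _) fun (t : Fin T) _ => hfin t, expect_uniformOfFintype,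
    Fintype.card_fin, Fin.sum_univ_eq_sum_range fun t => expect (P.iterate γ m u₀ t) R,
    inv_mul_le_iff₀ hT, mul_add, mul_div_cancel₀ _ hT.ne']
  linarith

namespace Regular

variable {L G M : ℝ} (hP : P.Regular L G M)
include hP

theorem update_mem {m : ℕ} (γ : ℝ) (u : EuclideanSpace ℝ (Fin d) × ℝ) (x : P.𝒳)
    (ω : Fin m → P.𝒳) : WithLp.toLp 2 (P.update γ u x ω) ∈ P.feas := by
  rw [toLp_update]
  exact hP.isProjOnto_projFeas.mem _

theorem norm_stochGrad_le {m : ℕ} (x : P.𝒳) (ω : Fin m → P.𝒳) {u : Joint d} (hu : u ∈ P.feas) :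
    ‖P.stochGrad x ω u‖ ≤ G + P.εx := by
  refine (norm_add_le _ _).trans (add_le_add ?_ ?_)
  · exact norm_wmean_le (fun j => (P.g_pos _ _ _ _).le) hP.G_nonneg
      fun j => hP.norm_score_le _ _ u hu
  · refine (norm_joint_le _).trans_eq ?_
    simp [radiusGrad, abs_of_pos hP.εx_pos]

/-- One iteration of the biased stochastic gradient descent, compared with a feasible point. -/
theorem expect_step_norm_sq_le {γ : ℝ} (hγ : 0 ≤ γ) {m : ℕ} (hm : 0 < m)
    {u : EuclideanSpace ℝ (Fin d) × ℝ} (hu : WithLp.toLp 2 u ∈ P.feas)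
    {z : Joint d} (hz : z ∈ P.feas) :
    expect (P.step γ m u) (fun w => ‖WithLp.toLp 2 w - z‖ ^ 2) ≤
      ‖WithLp.toLp 2 u - z‖ ^ 2
        - 2 * γ * ⟪P.gradObjective (WithLp.toLp 2 u), WithLp.toLp 2 u - z⟫
        + 2 * γ * (4 * G * P.𝒳.card / m * ‖WithLp.toLp 2 u - z‖)
        + γ ^ 2 * (G + P.εx) ^ 2 := by
  have := P.nonempty_contexts
  set v : Joint d := WithLp.toLp 2 u with hv
  set C := 4 * G * P.𝒳.card / m * ‖v - z‖ with hC
  have hN : (0 : ℝ) < Fintype.card (Fin m → P.𝒳) := by exact_mod_cast Fintype.card_pos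
  have hx : ∀ x, (Fintype.card (Fin m → P.𝒳) : ℝ)⁻¹ * ∑ ω : Fin m → P.𝒳,
      ‖WithLp.toLp 2 (P.update γ u x ω) - z‖ ^ 2 ≤
      ‖v - z‖ ^ 2 - 2 * γ * (⟪wmean (fun ζ => P.g x ζ v.fst v.snd) fun ζ => P.score x ζ v, v - z⟫
        + ⟪P.radiusGrad, v - z⟫) + 2 * γ * C + γ ^ 2 * (G + P.εx) ^ 2 := by
    intro x
    -- The scalar bias bound is applied to the inner products of the scores with `v - z`, which are
    -- at most `G ‖v - z‖`; no vector-valued version is needed.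
    have hbias := abs_bias_le (g := fun ζ => P.g x ζ v.fst v.snd)
      (f := fun ζ => ⟪P.score x ζ v, v - z⟫) (fun ζ => P.g_pos _ _ _ _) (R := G * ‖v - z‖)
      (fun ζ => (abs_real_inner_le_norm _ _).trans
        (mul_le_mul_of_nonneg_right (hP.norm_score_le x ζ v hu) (norm_nonneg _))) hm
    rw [← inner_wmean] at hbias
    set A := (Fintype.card (Fin m → P.𝒳) : ℝ)⁻¹ * ∑ ω : Fin m → P.𝒳,
      (∑ j, P.g x (ω j) v.fst v.snd)⁻¹ * ∑ j, P.g x (ω j) v.fst v.snd *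
        ⟪P.score x (ω j) v, v - z⟫ with hA
    have e1 : 4 * (G * ‖v - z‖) * (Fintype.card P.𝒳 : ℝ) / m = C := by
      rw [Fintype.card_coe]; ring
    rw [e1] at hbias
    have hpt : ∀ ω : Fin m → P.𝒳, ‖WithLp.toLp 2 (P.update γ u x ω) - z‖ ^ 2 ≤
        (‖v - z‖ ^ 2 - 2 * γ * ⟪P.radiusGrad, v - z⟫ + γ ^ 2 * (G + P.εx) ^ 2) -
          2 * γ * ((∑ j, P.g x (ω j) v.fst v.snd)⁻¹ * ∑ j, P.g x (ω j) v.fst v.snd *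
            ⟪P.score x (ω j) v, v - z⟫) := by
      intro ω
      rw [toLp_update]
      refine (hP.isProjOnto_projFeas.norm_step_sq_le hz γ _).trans ?_
      have h1 := hP.norm_stochGrad_le x ω hu
      have h2 : ‖P.stochGrad x ω v‖ ^ 2 ≤ (G + P.εx) ^ 2 := by gcongr
      have h3 := mul_le_mul_of_nonneg_left h2 (sq_nonneg γ)
      have h4 : ⟪P.stochGrad x ω v, v - z⟫ = (∑ j, P.g x (ω j) v.fst v.snd)⁻¹ *
          (∑ j, P.g x (ω j) v.fst v.snd * ⟪P.score x (ω j) v, v - z⟫) +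
            ⟪P.radiusGrad, v - z⟫ := by
        rw [stochGrad, inner_add_left, inner_wmean]
      rw [← hv, h4]
      linarith
    calc _ ≤ (Fintype.card (Fin m → P.𝒳) : ℝ)⁻¹ * ∑ ω : Fin m → P.𝒳, _ :=
          mul_le_mul_of_nonneg_left (Finset.sum_le_sum fun ω _ => hpt ω) (by positivity)
      _ = (‖v - z‖ ^ 2 - 2 * γ * ⟪P.radiusGrad, v - z⟫ + γ ^ 2 * (G + P.εx) ^ 2) -
          2 * γ * A := by
        rw [Finset.sum_sub_distrib, ← Finset.mul_sum, Finset.sum_const, Finset.card_univ,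
          nsmul_eq_mul, mul_sub, inv_mul_cancel_left₀ hN.ne', hA]
        ring
      _ ≤ _ := by
        have h1 := (abs_le.1 hbias).1
        nlinarith
  rw [expect_step]
  have hsum := Finset.sum_le_sum fun x (_ : x ∈ Finset.univ) =>
    mul_le_mul_of_nonneg_left (hx x) (ENNReal.toReal_nonneg (a := P.ctx x))
  refine hsum.trans_eq ?_
  rw [gradObjective, inner_add_left, sum_inner]
  simp only [real_inner_smul_left, mul_add, mul_sub, Finset.sum_add_distrib,
    Finset.sum_sub_distrib, ← Finset.sum_mul, P.sum_ctx, one_mul]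
  rw [Finset.mul_sum]
  congr 4
  exact Finset.sum_congr rfl fun x _ => mul_left_comm _ _ _

/-- `F` is continuous and bounded below on a closed set, and the quadratic term is coercive.
Uniqueness of the minimizer plays no role later. -/
theorem exists_prox {κ : ℝ} (hκ : 0 < κ) {u : Joint d} (hu : u ∈ P.feas) :
    ∃ y ∈ P.feas, ∀ z ∈ P.feas, P.objective y.fst y.snd + κ * ‖y - u‖ ^ 2 ≤
      P.objective z.fst z.snd + κ * ‖z - u‖ ^ 2 := by
  have hcont : ContinuousOn (fun z : Joint d => P.objective z.fst z.snd + κ * ‖z - u‖ ^ 2)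
      P.feas :=
    hP.continuousOn_objective.add (by fun_prop)
  have hlim : Tendsto (fun z : Joint d => -M - Real.log P.𝒳.card / P.η + κ * ‖z - u‖ ^ 2)
      (cocompact _) atTop := by
    refine tendsto_atTop_add_const_left _ _ (Tendsto.const_mul_atTop hκ ?_)
    refine (tendsto_pow_atTop two_ne_zero).comp ?_
    simpa only [dist_eq_norm] using tendsto_dist_right_cocompact_atTop u
  have hev : ∀ᶠ z : Joint d in cocompact _ ⊓ 𝓟 P.feas,
      P.objective u.fst u.snd + κ * ‖u - u‖ ^ 2 ≤ P.objective z.fst z.snd + κ * ‖z - u‖ ^ 2 := by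
    rw [eventually_inf_principal]
    filter_upwards [hlim.eventually_ge_atTop (P.objective u.fst u.snd + κ * ‖u - u‖ ^ 2)]
      with z hz hzf
    have := (le_add_of_nonneg_right (mul_nonneg hP.εx_pos.le hzf.2)).trans (hP.le_objective hzf)
    linarith
  obtain ⟨y, hy, hmin⟩ := hcont.exists_isMinOn' hP.isClosed_feas hu hev
  exact ⟨y, hy, fun z hz => hmin hz⟩

end Regular

end Problem

/-! ### Convergence rates -/

namespace Problem

namespace Regular

variable {d q k : ℕ} {P : Problem d q k} {L G M : ℝ} (hP : P.Regular L G M)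
include hP

/-- Convergence of the output for convex costs. The batch sizes enter through the bound `b`
for the bias. -/
theorem expect_objective_sub_le
    (hl : ∀ ζ, ConvexOn ℝ P.Θ (fun θ => P.lhat θ ζ)) {D : ℝ} (hD : ∀ θ ∈ P.Θ, ‖θ‖ ≤ D)
    {Λ : ℝ} (hΛ : M + M + Real.log P.𝒳.card / P.η = P.εx * Λ)
    {c b : ℝ} (hc : 0 < c) (hb : b ≤ P.εx / 2) {T : ℕ} [NeZero T] {m : ℕ → ℕ}
    (hm : ∀ t < T, 0 < m t) (hmb : ∀ t < T, 4 * G * P.𝒳.card / m t ≤ b)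
    {u₀ : EuclideanSpace ℝ (Fin d) × ℝ} (hu₀ : WithLp.toLp 2 u₀ ∈ P.feas)
    {z : Joint d} (hz : z ∈ P.feas) (hzΛ : z.snd ≤ Λ) :
    expect (P.output T (fun _ => c / Real.sqrt T) m u₀) (fun u => P.objective u.1 u.2) -
      P.objective z.fst z.snd ≤
      ((2 * D + u₀.2 + Λ) ^ 2 / c + c * (G + P.εx) ^ 2) / Real.sqrt T +
        2 * b * (2 * D + 3 * Λ) := by
  have hε := hP.εx_pos
  have hT : (0 : ℝ) < T := by exact_mod_cast Nat.pos_of_neZero T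
  have hb0 : 0 ≤ b := le_trans (div_nonneg (mul_nonneg (mul_nonneg (by norm_num) hP.G_nonneg)
    (Nat.cast_nonneg _)) (Nat.cast_nonneg _)) (hmb 0 (Nat.pos_of_neZero T))
  set s := Real.sqrt T with hs
  have hs0 : 0 < s := Real.sqrt_pos.2 hT
  have hsT : s ^ 2 = T := Real.sq_sqrt hT.le
  set γ := c / s with hγ
  have hγ0 : 0 < γ := div_pos hc hs0
  set Fz := P.objective z.fst z.snd with hFz
  set E := 2 * D + 3 * Λ with hE
  have hdist : ∀ u ∈ P.feas, ‖u - z‖ ≤ 2 * D + u.snd + Λ := by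
    intro u hu
    refine (norm_joint_le _).trans ?_
    have h1 : ‖(u - z).fst‖ ≤ D + D := (norm_sub_le _ _).trans (add_le_add (hD _ hu.1) (hD _ hz.1))
    have h2 : |(u - z).snd| ≤ u.snd + z.snd := by
      rw [WithLp.sub_snd, abs_le]
      constructor <;> linarith [hu.2, hz.2]
    linarith
  -- The unbounded part of the distance is traded for the objective gap through the growth of `F` in
  -- `λ`.
  have hdist' : ∀ u ∈ P.feas, ‖u - z‖ ≤ (P.objective u.fst u.snd - Fz) / P.εx + E := by
    intro u hu
    have h1 := hP.le_objective hu
    have h2 := hP.objective_le hz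
    have h3 := mul_le_mul_of_nonneg_left hzΛ hε.le
    have h4 : u.snd ≤ (P.objective u.fst u.snd - Fz) / P.εx + 2 * Λ := by
      rw [← sub_le_iff_le_add, le_div_iff₀ hε]
      linarith
    linarith [hdist u hu]
  have hgrad : ∀ u ∈ P.feas, P.objective u.fst u.snd - Fz ≤ ⟪P.gradObjective u, u - z⟫ := by
    intro u hu
    have h1 := hP.objective_add_inner_le le_rfl (fun ζ θ hθ θ' hθ' => by
      have := inner_gradient_le_sub_of_convexOn (hl ζ) hθ hθ' ((hP.smooth ζ).1 θ hθ)
      linarith) hu hz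
    rw [← neg_sub u z, inner_neg_right] at h1
    linarith
  have hdesc := expect_output_le_of_descent (P := P) (S := {u | WithLp.toLp 2 u ∈ P.feas})
    (V := fun u => ‖WithLp.toLp 2 u - z‖ ^ 2)
    -- The factor `1 - b / ε_x` is what is left of the descent after absorbing the bias; it is at
    -- least `1 / 2` because `b ≤ ε_x / 2`.
    (R := fun u => 2 * γ * (1 - b / P.εx) * (P.objective u.1 u.2 + -Fz))
    (V₀ := 0) (κ := 2 * γ * (b * E) + γ ^ 2 * (G + P.εx) ^ 2) (γ := fun _ => γ) (m := m) (T := T)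
    hu₀ (fun t u _ x ω => hP.update_mem _ u x ω) (fun u _ => sq_nonneg _) (fun t ht u hu => by
      refine (hP.expect_step_norm_sq_le hγ0.le (hm t ht) hu hz).trans ?_
      have h1 := mul_le_mul_of_nonneg_left (hgrad _ hu) (by positivity : 0 ≤ 2 * γ)
      have h2 : 4 * G * P.𝒳.card / m t * ‖WithLp.toLp 2 u - z‖ ≤
          b * ((P.objective u.1 u.2 - Fz) / P.εx + E) :=
        mul_le_mul (hmb t ht) (hdist' _ hu) (norm_nonneg _) hb0
      have h3 := mul_le_mul_of_nonneg_left h2 (by positivity : 0 ≤ 2 * γ)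
      have e : 2 * γ * (1 - b / P.εx) * (P.objective u.1 u.2 + -Fz) =
          2 * γ * (P.objective u.1 u.2 - Fz) -
            2 * γ * (b * ((P.objective u.1 u.2 - Fz) / P.εx)) := by ring
      rw [e]
      simp only [WithLp.toLp_fst, WithLp.toLp_snd] at h1
      linarith)
  have hfin := P.finite_support_output T (fun _ => γ) m u₀
  rw [expect_const_mul, expect_add hfin, expect_const hfin, sub_zero] at hdesc
  set Y := expect (P.output T (fun _ => γ) m u₀) (fun u => P.objective u.1 u.2) with hY
  have hW : ‖WithLp.toLp 2 u₀ - z‖ ^ 2 ≤ (2 * D + u₀.2 + Λ) ^ 2 := by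
    have := hdist _ hu₀
    simp only [WithLp.toLp_snd] at this
    gcongr
  have hE0 : 0 ≤ b * E := by
    refine mul_nonneg hb0 ?_
    have h1 : 0 ≤ D := (norm_nonneg _).trans (hD _ hz.1)
    linarith [hz.2]
  set W := (2 * D + u₀.2 + Λ) ^ 2 with hWdef
  have hW0 : 0 ≤ W := sq_nonneg _
  have hsplit : 2 * γ * ((1 - b / P.εx) * (Y - Fz)) ≤
      2 * γ * ((W / c + c * (G + P.εx) ^ 2) / s / 2 + b * E) := by
    have e : 2 * γ * ((W / c + c * (G + P.εx) ^ 2) / s / 2 + b * E) =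
        W / T + (2 * γ * (b * E) + γ ^ 2 * (G + P.εx) ^ 2) := by
      rw [← hsT, hγ]
      field_simp
      ring
    have h1 := div_le_div_of_nonneg_right hW hT.le
    rw [e]
    linarith
  have hmain := le_of_mul_le_mul_left hsplit (by positivity)
  rcases le_total (Y - Fz) 0 with h | h
  · have : 0 ≤ (W / c + c * (G + P.εx) ^ 2) / s := by positivity
    linarith
  · have hbε : b / P.εx ≤ 1 / 2 := by
      rw [div_le_iff₀ hε]; linarith
    have := mul_le_mul_of_nonneg_right hbε h
    linarith

/-- Convergence of the gradient mapping at the output. -/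
theorem expect_gradMapSq_le {c b r : ℝ} (hc : 0 < c) (hr : 0 < r) {T : ℕ} [NeZero T] {m : ℕ → ℕ}
    (hm : ∀ t < T, 0 < m t) (hmb : ∀ t < T, 4 * G * P.𝒳.card / m t ≤ b)
    {u₀ : EuclideanSpace ℝ (Fin d) × ℝ} (hu₀ : WithLp.toLp 2 u₀ ∈ P.feas) :
    expect (P.output T (fun _ => c / Real.sqrt T) m u₀) (P.gradMapSq r) ≤
      (2 / r + (L + 16 * P.η * G ^ 2) + 2 * (L + 1)) ^ 2 *
        (((P.objective u₀.1 u₀.2 + M + Real.log P.𝒳.card / P.η) / ((L + 1) * c) +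
          c * (G + P.εx) ^ 2) / Real.sqrt T + b ^ 2) := by
  have hT : (0 : ℝ) < T := by exact_mod_cast Nat.pos_of_neZero T
  have hL := hP.L_nonneg
  set s := Real.sqrt T with hs
  have hs0 : 0 < s := Real.sqrt_pos.2 hT
  have hsT : s ^ 2 = T := Real.sq_sqrt hT.le
  set γ := c / s with hγ
  have hγ0 : 0 < γ := div_pos hc hs0
  -- `F` is weakly convex with constant `L`; the excess `1` is the margin that produces the decrease
  -- `Δ²` below.
  set κ := L + 1 with hκ
  have hκ0 : 0 < κ := by positivity
  set A := 2 / r + (L + 16 * P.η * G ^ 2) + 2 * κ with hA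
  set F : Joint d → ℝ := fun u => P.objective u.fst u.snd with hF
  have hlow : ∀ u ∈ P.feas, ∀ v ∈ P.feas,
      F u + ⟪P.gradObjective u, v - u⟫ - L * ‖v - u‖ ^ 2 ≤ F v := fun u hu v hv =>
    hP.objective_add_inner_le hL (fun ζ θ hθ θ' hθ' => by
      have := (abs_le.1 ((hP.smooth ζ).abs_sub_inner_le hL hP.convex hθ hθ')).1
      linarith) hu hv
  choose! y hy hmin using fun (u : Joint d) (hu : u ∈ P.feas) => hP.exists_prox hκ0 hu
  have hbelow : ∀ u ∈ P.feas, -M - Real.log P.𝒳.card / P.η ≤ F u := fun u hu =>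
    (le_add_of_nonneg_right (mul_nonneg hP.εx_pos.le hu.2)).trans (hP.le_objective hu)
  have hdesc := expect_output_le_of_descent (P := P) (S := {u | WithLp.toLp 2 u ∈ P.feas})
    (V := fun u => F (y (WithLp.toLp 2 u)) +
      κ * ‖y (WithLp.toLp 2 u) - WithLp.toLp 2 u‖ ^ 2)
    (R := fun u => γ * κ * ‖y (WithLp.toLp 2 u) - WithLp.toLp 2 u‖ ^ 2)
    (V₀ := -M - Real.log P.𝒳.card / P.η) (κ := γ * κ * b ^ 2 + κ * (γ ^ 2 * (G + P.εx) ^ 2))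
    (γ := fun _ => γ) (m := m) (T := T)
    hu₀ (fun t u _ x ω => hP.update_mem _ u x ω)
    (fun u hu => (hbelow _ (hy _ hu)).trans (le_add_of_nonneg_right (by positivity)))
    (fun t ht u hu => by
      have hfin := P.finite_support_step γ (m t) u
      set v : Joint d := WithLp.toLp 2 u with hv
      -- The old proximal point `y v` is a competitor in the problem defining the envelope at the
      -- new iterate, so the envelope is bounded by a squared distance to a fixed point.
      have h1 : expect (P.step γ (m t) u) (fun w => F (y (WithLp.toLp 2 w)) +
          κ * ‖y (WithLp.toLp 2 w) - WithLp.toLp 2 w‖ ^ 2) ≤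
          κ * expect (P.step γ (m t) u) (fun w => ‖WithLp.toLp 2 w - y v‖ ^ 2) + F (y v) := by
        refine (expect_mono hfin (f' := fun w => κ * ‖WithLp.toLp 2 w - y v‖ ^ 2 + F (y v))
          fun w hw => ?_).trans_eq (by rw [expect_add hfin, expect_const_mul, expect_const hfin])
        have hwf : w ∈ {u | WithLp.toLp 2 u ∈ P.feas} :=
          mem_of_mem_support_step (fun x ω => hP.update_mem _ u x ω) hw
        have := hmin _ hwf (y v) (hy v hu)
        rw [norm_sub_rev (WithLp.toLp 2 w) (y v)]
        linarith
      have h2 := hP.expect_step_norm_sq_le hγ0.le (hm t ht) hu (hy v hu)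
      have h3 := hlow v hu (y v) (hy v hu)
      have h4 := hmin v hu v hu
      rw [sub_self, norm_zero] at h4
      have h5 : ⟪P.gradObjective v, v - y v⟫ = -⟪P.gradObjective v, y v - v⟫ := by
        rw [← inner_neg_right, neg_sub]
      rw [← hv, h5, norm_sub_rev v (y v)] at h2
      set Δ := ‖y v - v‖ with hΔ
      -- Young's inequality: the bias consumes half of the decrease `2 γ Δ²` and leaves `γ b²`,
      -- quadratic in the bias.
      have h6 : 4 * G * P.𝒳.card / m t * Δ ≤ (Δ ^ 2 + b ^ 2) / 2 := by
        have := mul_le_mul_of_nonneg_right (hmb t ht) (norm_nonneg (y v - v))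
        nlinarith [sq_nonneg (Δ - b)]
      -- Minimality of `y v` against `v` gives `F (y v) - F v ≤ -κ Δ²`, and weak convexity costs `L
      -- Δ²`.
      have h7 : ⟪P.gradObjective v, y v - v⟫ ≤ -Δ ^ 2 := by
        have : F v = P.objective v.fst v.snd := rfl
        have h8 : F (y v) = P.objective (y v).fst (y v).snd := rfl
        have h9 : κ * Δ ^ 2 = L * Δ ^ 2 + Δ ^ 2 := by rw [hκ]; ring
        nlinarith
      have h10 := mul_le_mul_of_nonneg_left h6 (by positivity : 0 ≤ 2 * γ)
      have h11 := mul_le_mul_of_nonneg_left h7 (by positivity : 0 ≤ 2 * γ)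
      refine h1.trans ?_
      have h12 := mul_le_mul_of_nonneg_left (h2.trans
        (by linarith : _ ≤ Δ ^ 2 - γ * Δ ^ 2 + γ * b ^ 2 + γ ^ 2 * (G + P.εx) ^ 2)) hκ0.le
      linarith)
  have hfin := P.finite_support_output T (fun _ => γ) m u₀
  have hsupp : ∀ u ∈ (P.output T (fun _ => γ) m u₀).support, WithLp.toLp 2 u ∈ P.feas := by
    intro u hu
    rw [output, PMF.support_bind] at hu
    obtain ⟨t, -, ht⟩ := Set.mem_iUnion₂.1 hu
    exact mem_of_mem_support_iterate (S := {u | WithLp.toLp 2 u ∈ P.feas}) hu₀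
      (fun t u _ x ω => hP.update_mem _ u x ω) t ht
  have hgm : expect (P.output T (fun _ => γ) m u₀) (P.gradMapSq r) ≤
      A ^ 2 * expect (P.output T (fun _ => γ) m u₀)
        (fun u => ‖y (WithLp.toLp 2 u) - WithLp.toLp 2 u‖ ^ 2) := by
    rw [← expect_const_mul]
    refine expect_mono hfin fun u hu => ?_
    have huf := hsupp u hu
    rw [hP.gradMapSq_eq r huf, ← mul_pow]
    have := norm_gradMap_le hP.convex_feas hP.isProjOnto_projFeas hκ0.le hlow
      (fun u hu v hv => hP.norm_gradObjective_sub_le hu hv) huf (hy _ huf) (hmin _ huf) hr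
    gcongr
  refine hgm.trans (mul_le_mul_of_nonneg_left ?_ (sq_nonneg A))
  rw [expect_const_mul] at hdesc
  have h1 := hmin _ hu₀ _ hu₀
  rw [sub_self, norm_zero] at h1
  set Y := expect (P.output T (fun _ => γ) m u₀)
        (fun u => ‖y (WithLp.toLp 2 u) - WithLp.toLp 2 u‖ ^ 2) with hY
  set Z := P.objective u₀.1 u₀.2 + M + Real.log P.𝒳.card / P.η with hZ
  have h2 : (F (y (WithLp.toLp 2 u₀)) + κ * ‖y (WithLp.toLp 2 u₀) - WithLp.toLp 2 u₀‖ ^ 2 -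
      (-M - Real.log P.𝒳.card / P.η)) / T ≤ Z / T := by
    refine div_le_div_of_nonneg_right ?_ hT.le
    simp only [WithLp.toLp_fst, WithLp.toLp_snd] at h1
    simp only [hF]
    linarith
  have e : γ * κ * ((Z / (κ * c) + c * (G + P.εx) ^ 2) / s + b ^ 2) =
      Z / T + (γ * κ * b ^ 2 + κ * (γ ^ 2 * (G + P.εx) ^ 2)) := by
    rw [← hsT, hγ]
    field_simp
    ring
  refine le_of_mul_le_mul_left ?_ (by positivity : 0 < γ * κ)
  rw [e]
  linarith

end Regular

/-! ### Query counts and the choice of constants -/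

theorem totalQueries_ceil_le {a b : ℝ} (ha : 0 ≤ a) (hb : 0 ≤ b) :
    (totalQueries ⌈a⌉₊ (fun _ => ⌈b⌉₊) : ℝ) ≤ (a + 1) * (b + 1) := by
  rw [totalQueries, Finset.sum_const, Finset.card_range, smul_eq_mul, Nat.cast_mul]
  exact mul_le_mul (Nat.ceil_lt_add_one ha).le (Nat.ceil_lt_add_one hb).le (Nat.cast_nonneg _)
    (by positivity)

end Problem

theorem div_sqrt_le_half {K e : ℝ} (hK : 0 ≤ K) (he : 0 < e) {T : ℕ}
    (hT : (2 * K + 1) ^ 2 / e ^ 2 ≤ T) : K / Real.sqrt T ≤ e / 2 := by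
  have h1 : (2 * K + 1) / e ≤ Real.sqrt T :=
    Real.le_sqrt_of_sq_le (by rwa [div_pow])
  have h2 : 0 < (2 * K + 1) / e := by positivity
  rw [div_le_div_iff₀ (h2.trans_le h1) two_pos]
  rw [div_le_iff₀ he] at h1
  linarith

theorem pos_and_div_le_of_div_le {C D e : ℝ} (hC : 0 ≤ C) (hD : 0 < D) (he : 0 < e) {m : ℕ}
    (hm : D / e ≤ m) : 0 < m ∧ C / m ≤ C * e / D := by
  have h1 : 0 < D / e := by positivity
  have h2 : (0 : ℝ) < m := h1.trans_le hm
  refine ⟨by exact_mod_cast h2, ?_⟩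
  rw [div_le_div_iff₀ h2 hD, mul_assoc]
  rw [div_le_iff₀ he, mul_comm] at hm
  exact mul_le_mul_of_nonneg_left hm hC

/-- The `+ 1` from rounding up is at most `(δ₀ / δ) ^ n`, so it can be absorbed in the constant; an
upper bound on `δ` is necessary for this. -/
theorem add_one_le_div_pow {A δ δ₀ : ℝ} (hδ : 0 < δ) (hδ' : δ ≤ δ₀) (n : ℕ) :
    A / δ ^ n + 1 ≤ (A + δ₀ ^ n) / δ ^ n := by
  rw [add_div]
  exact add_le_add le_rfl ((one_le_div (by positivity)).2 (by gcongr))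

/-- The number of queries with `⌈A / δ ^ i⌉` iterations and batches of `⌈D / δ ^ j⌉` samples. -/
theorem totalQueries_ceil_le_div_pow {A D δ δ₀ : ℝ} (hA : 0 ≤ A) (hD : 0 ≤ D) (hδ : 0 < δ)
    (hδ' : δ ≤ δ₀) (i j : ℕ) :
    (totalQueries ⌈A / δ ^ i⌉₊ (fun _ => ⌈D / δ ^ j⌉₊) : ℝ) ≤
      (A + δ₀ ^ i) * (D + δ₀ ^ j) / δ ^ (i + j) := by
  have hδ₀ := hδ.trans_le hδ'
  have h1 := add_one_le_div_pow (A := A) hδ hδ' i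
  have h2 := add_one_le_div_pow (A := D) hδ hδ' j
  rw [pow_add, ← div_mul_div_comm]
  exact (Problem.totalQueries_ceil_le (by positivity) (by positivity)).trans
    (mul_le_mul h1 h2 (by positivity) (by positivity))

/-! ### Complexity bounds -/

namespace Problem.Regular

variable {d q k : ℕ} {P : Problem d q k} {L G M : ℝ}

theorem exists_complexity_of_convexOn (hP : P.Regular L G M)
    (hl : ∀ ζ, ConvexOn ℝ P.Θ (fun θ => P.lhat θ ζ))
    {u₀ : EuclideanSpace ℝ (Fin d) × ℝ} (hu₀ : WithLp.toLp 2 u₀ ∈ P.feas)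
    {c δ₀ : ℝ} (hc : 0 < c) (hδ₀ : 0 < δ₀) :
    ∃ Cm CT CQ : ℝ, 0 < Cm ∧ 0 < CT ∧ 0 < CQ ∧ ∀ δ : ℝ, 0 < δ → δ ≤ δ₀ →
      (∀ (T : ℕ) [NeZero T] (m : ℕ → ℕ),
        CT / δ ^ 2 ≤ T → (∀ t < T, Cm / δ ≤ m t) →
        ∀ θ ∈ P.Θ, ∀ lam : ℝ, 0 ≤ lam →
          expect (P.output T (fun _ => c / Real.sqrt T) m u₀)
            (fun u => P.objective u.1 u.2) - P.objective θ lam ≤ δ) ∧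
      (totalQueries ⌈CT / δ ^ 2⌉₊ (fun _ => ⌈Cm / δ⌉₊) : ℝ) ≤ CQ / δ ^ 3 := by
  have hε := hP.εx_pos
  have hη := hP.η_pos
  have hG := hP.G_nonneg
  obtain ⟨D, hD⟩ := hP.isCompact.isBounded.exists_norm_le
  have hD0 : 0 ≤ D := (norm_nonneg _).trans (hD _ hu₀.1)
  obtain ⟨x⟩ := P.nonempty_contexts
  have hM0 : 0 ≤ M := (abs_nonneg _).trans (hP.abs_lhat_le _ hu₀.1 x)
  have hlog : 0 ≤ Real.log P.𝒳.card := Real.log_natCast_nonneg _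
  -- The threshold at which the lower bound for `F (θ, λ)` reaches the upper bound `M` for `F (θ,
  -- 0)`.
  obtain ⟨Λ, hΛ0, hΛ⟩ : ∃ Λ : ℝ, 0 ≤ Λ ∧ M + M + Real.log P.𝒳.card / P.η = P.εx * Λ :=
    ⟨(M + M + Real.log P.𝒳.card / P.η) / P.εx, by positivity, (mul_div_cancel₀ _ hε.ne').symm⟩
  have hrate : ∀ b, b ≤ P.εx / 2 → ∀ (T : ℕ) [NeZero T] (m : ℕ → ℕ), (∀ t < T, 0 < m t) →
      (∀ t < T, 4 * G * P.𝒳.card / m t ≤ b) → ∀ z ∈ P.feas, z.snd ≤ Λ →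
      expect (P.output T (fun _ => c / Real.sqrt T) m u₀) (fun u => P.objective u.1 u.2) -
        P.objective z.fst z.snd ≤ _ :=
    fun b hb T _ m hm hmb z hz hzΛ => hP.expect_objective_sub_le hl hD hΛ hc hb hm hmb hu₀ hz hzΛ
  have hK0 : 0 ≤ (2 * D + u₀.2 + Λ) ^ 2 / c + c * (G + P.εx) ^ 2 := by positivity
  have hE0 : 0 ≤ 2 * D + 3 * Λ := by positivity
  have hC0 : 0 ≤ 4 * G * P.𝒳.card := by positivity
  generalize (2 * D + u₀.2 + Λ) ^ 2 / c + c * (G + P.εx) ^ 2 = K at hrate hK0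
  generalize 2 * D + 3 * Λ = E at hrate hE0
  generalize 4 * G * (P.𝒳.card : ℝ) = C at hrate hC0
  -- The first bound makes the bias term at most `δ / 2`; the second ensures `b ≤ ε_x / 2` for all
  -- `δ ≤ δ₀`, as the absorption requires.
  obtain ⟨Cm, hCm0, hCE, hCδ⟩ : ∃ Cm : ℝ, 0 < Cm ∧ 4 * C * E ≤ Cm ∧ 2 * C * δ₀ / P.εx ≤ Cm := by
    have h1 : 0 ≤ 4 * C * E := by positivity
    have h2 : 0 ≤ 2 * C * δ₀ / P.εx := by positivity
    exact ⟨4 * C * E + 2 * C * δ₀ / P.εx + 1, by linarith, by linarith, by linarith⟩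
  refine ⟨Cm, (2 * K + 1) ^ 2, ((2 * K + 1) ^ 2 + δ₀ ^ 2) * (Cm + δ₀ ^ 1), hCm0, by positivity,
    by positivity, fun δ hδ hδ' => ⟨?_, ?_⟩⟩
  · intro T _ m hT hm
    have hbatch : ∀ t < T, 0 < m t ∧ C / m t ≤ C * δ / Cm := fun t ht =>
      pos_and_div_le_of_div_le hC0 hCm0 hδ (hm t ht)
    have hb : C * δ / Cm ≤ P.εx / 2 := by
      rw [div_le_div_iff₀ hCm0 two_pos]
      rw [div_le_iff₀ hε] at hCδ
      have := mul_le_mul_of_nonneg_left hδ' hC0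
      linarith
    have hbE : 2 * (C * δ / Cm) * E ≤ δ / 2 := by
      have h2 : 2 * (C * δ / Cm) * E = δ / 2 * (4 * C * E / Cm) := by ring
      rw [h2]
      exact mul_le_of_le_one_right (by positivity) ((div_le_one hCm0).2 hCE)
    have hsqrt := div_sqrt_le_half hK0 hδ hT
    have hbound : ∀ z ∈ P.feas, z.snd ≤ Λ →
        expect (P.output T (fun _ => c / Real.sqrt T) m u₀) (fun u => P.objective u.1 u.2) -
          P.objective z.fst z.snd ≤ δ := by
      intro z hz hzΛ
      have := hrate _ hb T m (fun t ht => (hbatch t ht).1) (fun t ht => (hbatch t ht).2) z hz hzΛ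
      linarith
    intro θ hθ lam hlam
    rcases le_total lam Λ with h | h
    · exact hbound (WithLp.toLp 2 (θ, lam)) ⟨hθ, hlam⟩ h
    -- Beyond `Λ` the comparator is no better than `(θ, 0)`, which is already covered.
    · have hz0 : WithLp.toLp 2 (θ, (0 : ℝ)) ∈ P.feas := ⟨hθ, le_refl (0 : ℝ)⟩
      have h1 := hbound _ hz0 hΛ0
      have h2 := hP.objective_le hz0
      have h3 := hP.le_objective (u := WithLp.toLp 2 (θ, lam)) ⟨hθ, hlam⟩
      have h4 := mul_le_mul_of_nonneg_left h hε.le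
      simp only [WithLp.toLp_fst, WithLp.toLp_snd] at h1 h2 h3
      linarith
  · simpa only [pow_one] using
      totalQueries_ceil_le_div_pow (sq_nonneg (2 * K + 1)) hCm0.le hδ hδ' 2 1

theorem exists_complexity (hP : P.Regular L G M)
    {u₀ : EuclideanSpace ℝ (Fin d) × ℝ} (hu₀ : WithLp.toLp 2 u₀ ∈ P.feas)
    {c δ₀ r : ℝ} (hc : 0 < c) (hδ₀ : 0 < δ₀) (hr : 0 < r) :
    ∃ Cm CT CQ : ℝ, 0 < Cm ∧ 0 < CT ∧ 0 < CQ ∧ ∀ δ : ℝ, 0 < δ → δ ≤ δ₀ →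
      (∀ (T : ℕ) [NeZero T] (m : ℕ → ℕ),
        CT / δ ^ 4 ≤ T → (∀ t < T, Cm / δ ^ 2 ≤ m t) →
          expect (P.output T (fun _ => c / Real.sqrt T) m u₀) (P.gradMapSq r) ≤ δ ^ 2) ∧
      (totalQueries ⌈CT / δ ^ 4⌉₊ (fun _ => ⌈Cm / δ ^ 2⌉₊) : ℝ) ≤ CQ / δ ^ 6 := by
  have hε := hP.εx_pos
  have hη := hP.η_pos
  have hG := hP.G_nonneg
  have hL := hP.L_nonneg
  have hZ0 : 0 ≤ P.objective u₀.1 u₀.2 + M + Real.log P.𝒳.card / P.η := by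
    have h1 := hP.le_objective hu₀
    have h2 := mul_nonneg hε.le hu₀.2
    simp only [WithLp.toLp_fst, WithLp.toLp_snd] at h1 h2
    linarith
  have hrate : ∀ b, ∀ (T : ℕ) [NeZero T] (m : ℕ → ℕ), (∀ t < T, 0 < m t) →
      (∀ t < T, 4 * G * P.𝒳.card / m t ≤ b) →
      expect (P.output T (fun _ => c / Real.sqrt T) m u₀) (P.gradMapSq r) ≤ _ :=
    fun b T _ m hm hmb => hP.expect_gradMapSq_le hc hr hm hmb hu₀
  have hK0 : 0 ≤ (P.objective u₀.1 u₀.2 + M + Real.log P.𝒳.card / P.η) / ((L + 1) * c) +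
    c * (G + P.εx) ^ 2 := by positivity
  have hA0 : 0 ≤ 2 / r + (L + 16 * P.η * G ^ 2) + 2 * (L + 1) := by positivity
  have hC0 : 0 ≤ 4 * G * P.𝒳.card := by positivity
  generalize (P.objective u₀.1 u₀.2 + M + Real.log P.𝒳.card / P.η) / ((L + 1) * c) +
    c * (G + P.εx) ^ 2 = K at hrate hK0
  generalize 2 / r + (L + 16 * P.η * G ^ 2) + 2 * (L + 1) = A at hrate hA0
  generalize 4 * G * (P.𝒳.card : ℝ) = C at hrate hC0
  -- The bias enters squared, so only `A b ≤ δ / 2` is needed. Batches of order `δ⁻²` give `b` of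
  -- order `δ²`, and the spare factor `δ` is bounded by `δ₀`. The error is then at most `δ² / 2 + δ²
  -- / 4`.
  obtain ⟨Cm, hCm0, hCA⟩ : ∃ Cm : ℝ, 0 < Cm ∧ 2 * A * C * δ₀ ≤ Cm :=
    ⟨2 * A * C * δ₀ + 1, by positivity, by linarith⟩
  have hAK : 0 ≤ A ^ 2 * K := by positivity
  refine ⟨Cm, (2 * (A ^ 2 * K) + 1) ^ 2, ((2 * (A ^ 2 * K) + 1) ^ 2 + δ₀ ^ 4) * (Cm + δ₀ ^ 2),
    hCm0, by positivity, by positivity, fun δ hδ hδ' => ⟨?_, ?_⟩⟩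
  · intro T _ m hT hm
    have hbatch : ∀ t < T, 0 < m t ∧ C / m t ≤ C * δ ^ 2 / Cm := fun t ht =>
      pos_and_div_le_of_div_le hC0 hCm0 (by positivity) (hm t ht)
    have hb : A * (C * δ ^ 2 / Cm) ≤ δ / 2 := by
      have h1 : A * (C * δ ^ 2 / Cm) = δ / 2 * (2 * A * C * δ / Cm) := by ring
      rw [h1]
      refine mul_le_of_le_one_right (by positivity) ((div_le_one hCm0).2 (le_trans ?_ hCA))
      gcongr
    have hb2 : A ^ 2 * (C * δ ^ 2 / Cm) ^ 2 ≤ (δ / 2) ^ 2 := by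
      rw [← mul_pow]
      gcongr
    have hsqrt := div_sqrt_le_half hAK (by positivity : 0 < δ ^ 2) (T := T)
      (by rwa [← pow_mul])
    refine (hrate _ T m (fun t ht => (hbatch t ht).1) fun t ht => (hbatch t ht).2).trans ?_
    rw [mul_add, ← mul_div_assoc]
    nlinarith [sq_nonneg δ]
  · exact totalQueries_ceil_le_div_pow (sq_nonneg _) hCm0.le hδ hδ' 4 2

end Problem.Regular

end WassersteinOPL

end

theorem mainTheorem4 {d q k : ℕ} (P : WassersteinOPL.Problem d q k)
    (hη : 0 < P.η) (hε : 0 < P.εx)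
    (hcompact : IsCompact P.Θ) (hconvex : Convex ℝ P.Θ)
    (hpol : ∀ θ ∈ P.Θ, ∀ ζ, P.pol θ ζ ∈ stdSimplex ℝ (Fin k))
    (B : ℝ) (hB : 0 < B) (hdiam : ∀ x ∈ P.𝒳, ∀ y ∈ P.𝒳, ‖x - y‖ ≤ B)
    (L : ℝ) (hsmooth : ∀ ζ, WassersteinOPL.SmoothOn L (fun θ => P.lhat θ ζ) P.Θ)
    (θ₀ : EuclideanSpace ℝ (Fin d)) (hθ₀ : θ₀ ∈ P.Θ) (lam₀ : ℝ) (hlam₀ : 0 ≤ lam₀)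
    (c : ℝ) (hc : 0 < c) (δ₀ : ℝ) (hδ₀ : 0 < δ₀) :
    ((∀ ζ, ConvexOn ℝ P.Θ (fun θ => P.lhat θ ζ)) →
      ∃ Cm CT CQ : ℝ, 0 < Cm ∧ 0 < CT ∧ 0 < CQ ∧ ∀ δ : ℝ, 0 < δ → δ ≤ δ₀ →
        (∀ (T : ℕ) [NeZero T] (m : ℕ → ℕ),
          CT / δ ^ 2 ≤ T → (∀ t < T, Cm / δ ≤ m t) →
          ∀ θ ∈ P.Θ, ∀ lam : ℝ, 0 ≤ lam →
            WassersteinOPL.expect (P.output T (fun _ => c / Real.sqrt T) m (θ₀, lam₀))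
              (fun u => P.objective u.1 u.2) - P.objective θ lam ≤ δ) ∧
        (WassersteinOPL.totalQueries ⌈CT / δ ^ 2⌉₊ (fun _ => ⌈Cm / δ⌉₊) : ℝ) ≤ CQ / δ ^ 3) ∧
    (∀ r : ℝ, 0 < r →
      ∃ Cm CT CQ : ℝ, 0 < Cm ∧ 0 < CT ∧ 0 < CQ ∧ ∀ δ : ℝ, 0 < δ → δ ≤ δ₀ →
        (∀ (T : ℕ) [NeZero T] (m : ℕ → ℕ),
          CT / δ ^ 4 ≤ T → (∀ t < T, Cm / δ ^ 2 ≤ m t) →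
            WassersteinOPL.expect (P.output T (fun _ => c / Real.sqrt T) m (θ₀, lam₀))
              (P.gradMapSq r) ≤ δ ^ 2) ∧
        (WassersteinOPL.totalQueries ⌈CT / δ ^ 4⌉₊ (fun _ => ⌈Cm / δ ^ 2⌉₊) : ℝ) ≤
          CQ / δ ^ 6) := by
  obtain ⟨L', G, M, hP⟩ := WassersteinOPL.Problem.exists_regular hη hε hcompact hconvex hpol hdiam
    hsmooth hθ₀
  have hu₀ : WithLp.toLp 2 (θ₀, lam₀) ∈ P.feas := ⟨hθ₀, hlam₀⟩
  exact ⟨fun hl => hP.exists_complexity_of_convexOn hl hu₀ hc hδ₀,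
    fun r hr => hP.exists_complexity hu₀ hc hδ₀ hr⟩
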